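/- **Generalization bound with knowledge transfer.** *Setting.* Let $\mathcal X\subseteq\mathbb R^p$ be a set of instances with $\|\boldsymbol x\|\le B$ for all $\boldsymbol x\in\mathcal X$, and let $C$ be the number of classes. Let $\mathcal T$ be the set of all transition matrices $T:\mathcal X\to\mathbb R^{C\times C}$ of the form $T_{ij}(\boldsymbol x)=\exp(t_{ij}(\boldsymbol x))/\sum_{k=1}^C\exp(t_{ik}(\boldsymbol x))$, where $t(\boldsymbol x)=W_d\sigma_{d-1}(W_{d-1}\cdots\sigma_1(W_1\boldsymbol x))\in\mathbb R^{C\times C}$ is a $d$-layer network ($d\ge 1$) of given layer widths, whose weight matrices $W_1,\dots,W_d$ have Frobenius norms at most $M_1,\dots,M_d$ and whose fixed activations $\sigma_1,\dots,\sigma_{d-1}:\mathbb R\to\mathbb R$ are $1$-Lipschitz, positive-homogeneous and applied element-wise. $\mathcal T$ carries the $\sigma$-algebra generated by the evaluations $T\mapsto T(\boldsymbol x)$. For $z=(\boldsymbol x,\bar y,y^\star)$ in $\mathcal X\times[C]\times[C]$ let $\ell(T,z)=-\log T_{y^\star\bar y}(\boldsymbol x)$ be the cross-entropy loss of the label $\bar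 y$ under $\boldsymbol y^\star\cdot T(\boldsymbol x)$, where $\boldsymbol y^\star$ is the one-hot row vector of $y^\star$. Assume that $\ell(T,z)\le M$ for all $T\in\mathcal T$ and all $z$. Let $D_G$ and $D_I^1,\dots,D_I^R$ be probability distributions on $\mathcal X\times[C]\times[C]$ (global, and one for each of $R$ annotators). Let $\mathcal D_G$ be an i.i.d. sample of size $mr$ from $D_G$ ($m,r\ge1$), and, for each $j\in[R]$, let $\mathcal D_I^j$ be an i.i.d. sample of size $m_j\ge2$ from $D_I^j$, independent of $\mathcal D_G$. For $T\in\mathcal T$ put $\mathcal R_D(T)=\mathbb E_{z\sim D}\,\ell(T,z)$, and let $\hat{\mathcal R}_{\mathcal D}(T)$ be the average loss on a sample $\mathcal D$. For a stochastic hypothesis, i.e. a probability distribution $\tilde T$ on $\mathcal T$, put $\mathcal R'_D(\tilde T)=\mathbb E_{z\sim D,\,T\sim\tilde T}\,\ell(T,z)$ (with $z$ and $T$ independent) and $\hat{\mathcal R}'_{\mathcal D}(\tilde T)=\mathbb E_{T\sim\tilde T}\,\hat{\mathcal R}_{\mathcal D}(T)$. Let $\hat T\in\mathcal T$ (the learned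 global transition matrix), a prior $\tilde T_G$ (a stochastic hypothesis that is a measurable function of $\mathcal D_G$) and a set $\tilde{\mathcal T}$ of stochastic hypotheses be determined by $\mathcal D_G$, and let $\omega:\mathbb R\to\mathbb R$ be a non-decreasing function such that $$KL(\tilde T\,\|\,\tilde T_G)\le\omega\big(\mathcal R_{D_G}(\hat T)\big)\qquad\text{for all }\tilde T\in\tilde{\mathcal T}.$$ *Claim.* There is a constant $K$ depending only on $C$, $d$, $B$ and $M_1,\dots,M_d$ such that for every $j\in[R]$ and $\delta\in(0,1)$, with probability at least $1-\delta$ over $(\mathcal D_G,\mathcal D_I^j)$ both of the following hold. First, simultaneously for all $\tilde T^j\in\tilde{\mathcal T}$, $$\mathcal R'_{D_I^j}(\tilde T^j)-\hat{\mathcal R}'_{\mathcal D_I^j}(\tilde T^j)\le M\sqrt{\frac{\omega\big(\mathcal R_{D_G}(\hat T)\big)+\log(2m_j/\delta)}{2(m_j-1)}}.$$ Second, if the empirical risk of $\hat T$ is small, $\hat{\mathcal R}_{\mathcal D_G}(\hat T)\le c/\sqrt{mr}$ for some real $c$, then the right-hand side is at most $$M\sqrt{\frac{\omega\Big(\dfrac{c+K+M\sqrt{\log(2/\delta)/2}}{\sqrt{mr}}\Big)+\log(2m_j/\delta)}{2(m_j-1)}},$$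 which is the bound with $\omega(O(1/\sqrt{mr}))$. -/

import Mathlib

open MeasureTheory ProbabilityTheory InformationTheory
open scoped Matrix ENNReal

noncomputable section

namespace Crowd

/-- The Frobenius norm of a real matrix. -/
def frobNorm {a b : Type*} [Fintype a] [Fintype b] (W : Matrix a b ℝ) : ℝ :=
  open scoped Matrix.Norms.Frobenius in ‖W‖

/-- Output of the first `l` layers of a feed-forward network: layer `k` multiplies by the matrix
`W k` and applies the activation `σ k` element-wise. `w k` is the width of layer `k`, and `w 0` is
the dimension of the instances. -/
def hidden (w : ℕ → ℕ) (σ : ℕ → ℝ → ℝ) (W : ∀ k, Matrix (Fin (w (k + 1))) (Fin (w k)) ℝ)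
    (x : Fin (w 0) → ℝ) : (l : ℕ) → Fin (w l) → ℝ
  | 0 => x
  | l + 1 => fun i => σ l ((W l *ᵥ hidden w σ W x l) i)

/-- The network `t : x ↦ V σ_{L-1}(W_{L-1} ⋯ σ_0(W_0 x)) ∈ ℝ^{C × C}` with `L + 1` layers. -/
def network (C L : ℕ) (w : ℕ → ℕ) (σ : ℕ → ℝ → ℝ)
    (W : ∀ k, Matrix (Fin (w (k + 1))) (Fin (w k)) ℝ)
    (V : Matrix (Fin C × Fin C) (Fin (w L)) ℝ) (x : Fin (w 0) → ℝ) : Matrix (Fin C) (Fin C) ℝ :=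
  Matrix.of fun i j => (V *ᵥ hidden w σ W x L) (i, j)

/-- Row-wise softmax. -/
def rowSoftmax {C : ℕ} (t : Matrix (Fin C) (Fin C) ℝ) : Matrix (Fin C) (Fin C) ℝ :=
  Matrix.of fun i j => Real.exp (t i j) / ∑ k, Real.exp (t i k)

/-- The σ-algebra on matrices generated by the entries. -/
instance instMeasurableSpaceMatrix {C : ℕ} : MeasurableSpace (Matrix (Fin C) (Fin C) ℝ) :=
  inferInstanceAs (MeasurableSpace (Fin C → Fin C → ℝ))

/-- Instance-dependent transition matrices on the instance space `X`. -/
abbrev TransitionMap (C : ℕ) {p : ℕ} (X : Set (EuclideanSpace ℝ (Fin p))) : Type :=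
  X → Matrix (Fin C) (Fin C) ℝ

/-- The hypothesis space: transition matrices computed by networks with `L + 1` layers whose
weight matrices have Frobenius norms at most `Mw 0, …, Mw L`. As a type it carries the
σ-algebra generated by the evaluations `T ↦ T x`. -/
def hypothesisSpace (C L : ℕ) (w : ℕ → ℕ) (σ : ℕ → ℝ → ℝ) (Mw : Fin (L + 1) → ℝ)
    (X : Set (EuclideanSpace ℝ (Fin (w 0)))) : Set (TransitionMap C X) :=
  {T | ∃ (W : ∀ k, Matrix (Fin (w (k + 1))) (Fin (w k)) ℝ)
      (V : Matrix (Fin C × Fin C) (Fin (w L)) ℝ),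
      (∀ k : Fin L, frobNorm (W k) ≤ Mw k.castSucc) ∧ frobNorm V ≤ Mw (Fin.last L) ∧
      ∀ x : X, T x = rowSoftmax (network C L w σ W V (x : EuclideanSpace ℝ (Fin (w 0))).ofLp)}

/-- Data points `(x, ȳ, y⋆)`: instance, noisy label, Bayes optimal label. -/
abbrev Example (C : ℕ) {p : ℕ} (X : Set (EuclideanSpace ℝ (Fin p))) : Type :=
  X × Fin C × Fin C

/-- Cross-entropy of the distribution `q` relative to `y`. -/
def crossEntropy {C : ℕ} (y q : Fin C → ℝ) : ℝ := -∑ k, y k * Real.log (q k)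

/-- The loss `ℓ(ȳ, y⋆ · T(x))`, the labels being one-hot row vectors. -/
def loss {C p : ℕ} {X : Set (EuclideanSpace ℝ (Fin p))} (T : TransitionMap C X)
    (z : Example C X) : ℝ :=
  crossEntropy (Pi.single z.2.1 1) (Pi.single z.2.2 1 ᵥ* T z.1)

variable {C p : ℕ} {X : Set (EuclideanSpace ℝ (Fin p))}

/-- Expected loss of `T` under `D`. -/
def risk (D : Measure (Example C X)) (T : TransitionMap C X) : ℝ := ∫ z, loss T z ∂D

/-- Empirical loss of `T` on the sample `S`. -/
def empRisk {n : ℕ} (S : Fin n → Example C X) (T : TransitionMap C X) : ℝ :=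
  (1 / (n : ℝ)) * ∑ i, loss T (S i)

/-- Expected loss of the stochastic hypothesis `Q`: expectation over independent
`z ∼ D` and `T ∼ Q`. -/
def stochRisk {H : Set (TransitionMap C X)} (D : Measure (Example C X)) (Q : Measure H) : ℝ :=
  ∫ a, loss (a.2 : TransitionMap C X) a.1 ∂(D.prod Q)

/-- Empirical loss of the stochastic hypothesis `Q` on the sample `S`. -/
def stochEmpRisk {H : Set (TransitionMap C X)} {n : ℕ} (S : Fin n → Example C X)
    (Q : Measure H) : ℝ :=
  ∫ T, empRisk S (T : TransitionMap C X) ∂Q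

end Crowd

end

/-! Two estimates, each allowed to fail with probability `δ / 2`, are joined by a union bound.

The individual sample is handled by McAllester's PAC-Bayes argument. Hoeffding's tail gives, for
each fixed hypothesis, an exponential moment of the squared positive deviation that is at most the
sample size (`lintegral_exp_sq_deviation_le`). The prior sees only the global sample, so Tonelli
lets this moment be averaged over the prior, and Markov's inequality produces one exceptional event.
Off that event, Donsker–Varadhan (`integral_le_toReal_klDiv_add_log`) and Jensen bound all
posteriors at once; the divergence is then replaced by its bound through `ω`.

The global sample is handled by uniform convergence: McDiarmid concentrates the worst deviation
around its mean, and symmetrization bounds that mean by a Rademacher average. Cross-entropy is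
Lipschitz in one row of logits, so the contraction principle `exists_selection_le` reduces to
network outputs. Positive homogeneity reduces each hidden layer to a single neuron, and
`sum_norm_layer_le` peels it off at the cost of twice its norm bound. What remains is a sum of fixed
vectors with random signs, of size `B √n`, whatever the widths. Hence the risk of the learned map
exceeds its empirical risk by `O(1 / √(m r))`, and monotonicity of `ω` transfers this to the bound.

Rademacher averages are never written as suprema: they are bounded for every choice of a parameter
as a function of the signs. This avoids questions of boundedness and attainment. -/

namespace Crowd

/-! ### Rademacher signs -/

/-- The sign `±1` attached to a Boolean. -/
def sgn (b : Bool) : ℝ := if b then 1 else -1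

@[simp] lemma sgn_not (b : Bool) : sgn (!b) = -sgn b := by cases b <;> simp [sgn]

lemma sgn_mul_self (b : Bool) : sgn b * sgn b = 1 := by cases b <;> simp [sgn]

lemma abs_sgn (b : Bool) : |sgn b| = 1 := by cases b <;> simp [sgn]

section Signs

variable {ι : Type*} [DecidableEq ι]

/-- Flip the sign of the coordinate `i`. -/
def flipAt (i : ι) (ε : ι → Bool) : ι → Bool := Function.update ε i (!ε i)

@[simp] lemma flipAt_same (i : ι) (ε : ι → Bool) : flipAt i ε i = !ε i := by simp [flipAt]

lemma flipAt_of_ne {i j : ι} (h : j ≠ i) (ε : ι → Bool) : flipAt i ε j = ε j := by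
  simp [flipAt, h]

@[simp] lemma flipAt_flipAt (i : ι) (ε : ι → Bool) : flipAt i (flipAt i ε) = ε := by
  funext j
  by_cases h : j = i
  · subst h; simp
  · simp [flipAt_of_ne h]

lemma flipAt_involutive (i : ι) : Function.Involutive (flipAt i) := flipAt_flipAt i

variable [Fintype ι]

lemma sum_flipAt (i : ι) (φ : (ι → Bool) → ℝ) : ∑ ε, φ (flipAt i ε) = ∑ ε, φ ε :=
  (flipAt_involutive i).bijective.sum_comp φ

lemma sum_not (φ : (ι → Bool) → ℝ) : ∑ ε : ι → Bool, φ (fun i => !ε i) = ∑ ε, φ ε := by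
  have : Function.Involutive (fun (ε : ι → Bool) i => !ε i) := fun ε => by simp
  exact this.bijective.sum_comp φ

/-- Flipping the sign at `i` alone reverses every summand. This orthogonality kills the cross terms
in the second moment of a Rademacher sum. -/
lemma sum_sgn_mul_sgn {i j : ι} (h : i ≠ j) : ∑ ε : ι → Bool, sgn (ε i) * sgn (ε j) = 0 := by
  have := sum_flipAt i (fun ε : ι → Bool => sgn (ε i) * sgn (ε j))
  simp only [flipAt_same, flipAt_of_ne h.symm, sgn_not, neg_mul, Finset.sum_neg_distrib] at this
  linarith

/-- Comparison of Rademacher averages in a single coordinate. -/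
lemma exists_selection_le_single {Θ κ : Type*} [Fintype κ] [Nonempty κ] (i : ι)
    (A : (ι → Bool) → Θ → ℝ) (hA : ∀ ε, A (flipAt i ε) = A ε) (g : Θ → ℝ) (f : κ → Θ → ℝ)
    (hgf : ∀ a b, |g a - g b| ≤ ∑ k, |f k a - f k b|) (θ : (ι → Bool) → Θ) :
    ∃ (θ' : (ι → Bool) → Θ) (k : κ), ∑ ε, (A ε (θ ε) + sgn (ε i) * g (θ ε)) ≤
      ∑ ε, (A ε (θ' ε) + sgn (ε i) * (Fintype.card κ * f k (θ' ε))) := by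
  classical
  -- Within each pair `ε`, `flipAt i ε` the two parameters are kept or exchanged so that the signed
  -- increment of `f k` becomes its absolute value. The `A`-terms are at most permuted, since `A`
  -- ignores the flip.
  let θ' : κ → (ι → Bool) → Θ := fun k ε =>
    if 0 ≤ sgn (ε i) * (f k (θ ε) - f k (θ (flipAt i ε))) then θ ε else θ (flipAt i ε)
  let φ : (ι → Bool) → ℝ := fun ε => A ε (θ ε) + sgn (ε i) * g (θ ε)
  let ψ : κ → (ι → Bool) → ℝ := fun k ε =>
    A ε (θ' k ε) + sgn (ε i) * (Fintype.card κ * f k (θ' k ε))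
  have hφ : ∀ ε, φ ε + φ (flipAt i ε) ≤ A ε (θ ε) + A ε (θ (flipAt i ε)) +
      ∑ k, |f k (θ ε) - f k (θ (flipAt i ε))| := by
    intro ε
    have h1 := hgf (θ ε) (θ (flipAt i ε))
    have h2 : sgn (ε i) * (g (θ ε) - g (θ (flipAt i ε))) ≤ |g (θ ε) - g (θ (flipAt i ε))| := by
      refine (le_abs_self _).trans_eq ?_
      rw [abs_mul, abs_sgn, one_mul]
    simp only [φ, hA, flipAt_same, sgn_not]
    linarith
  have hψ : ∀ k ε, ψ k ε + ψ k (flipAt i ε) = A ε (θ ε) + A ε (θ (flipAt i ε)) +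
      Fintype.card κ * |f k (θ ε) - f k (θ (flipAt i ε))| := by
    intro k ε
    have habs : |f k (θ ε) - f k (θ (flipAt i ε))| =
        |sgn (ε i) * (f k (θ ε) - f k (θ (flipAt i ε)))| := by
      rw [abs_mul, abs_sgn, one_mul]
    have hsymm : sgn (flipAt i ε i) * (f k (θ (flipAt i ε)) - f k (θ ε)) =
        sgn (ε i) * (f k (θ ε) - f k (θ (flipAt i ε))) := by
      simp; ring
    rw [habs]
    by_cases h : 0 ≤ sgn (ε i) * (f k (θ ε) - f k (θ (flipAt i ε)))
    · have e1 : θ' k ε = θ ε := if_pos h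
      have e2 : θ' k (flipAt i ε) = θ (flipAt i ε) := by
        simp only [θ', hsymm, flipAt_flipAt]
        exact if_pos h
      simp only [ψ, e1, e2, hA, flipAt_same, sgn_not]
      rw [abs_of_nonneg h]; ring
    · have e1 : θ' k ε = θ (flipAt i ε) := if_neg h
      have e2 : θ' k (flipAt i ε) = θ ε := by
        simp only [θ', hsymm, flipAt_flipAt]
        exact if_neg h
      simp only [ψ, e1, e2, hA, flipAt_same, sgn_not]
      rw [abs_of_neg (not_le.1 h)]; ring
  have hdouble : ∀ χ : (ι → Bool) → ℝ, 2 * ∑ ε, χ ε = ∑ ε, (χ ε + χ (flipAt i ε)) := by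
    intro χ
    rw [Finset.sum_add_distrib, sum_flipAt]; ring
  have hcard : (0 : ℝ) < Fintype.card κ := by exact_mod_cast Fintype.card_pos
  -- The weight `card κ` in `ψ` makes the comparison true after summing over `k`; pigeonhole then
  -- gives one `k` serving all sign patterns.
  have htotal : ∑ _k : κ, ∑ ε, φ ε ≤ ∑ k, ∑ ε, ψ k ε := by
    have : 2 * ∑ _k : κ, ∑ ε, φ ε ≤ 2 * ∑ k, ∑ ε, ψ k ε := by
      rw [Finset.mul_sum (s := (Finset.univ : Finset κ)),
        Finset.mul_sum (s := (Finset.univ : Finset κ))]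
      simp only [hdouble]
      rw [Finset.sum_comm, Finset.sum_comm (s := (Finset.univ : Finset κ))]
      refine Finset.sum_le_sum fun ε _ => ?_
      simp only [hψ, Finset.sum_add_distrib, ← Finset.mul_sum, Finset.sum_const, Finset.card_univ,
        nsmul_eq_mul]
      have := mul_le_mul_of_nonneg_left (hφ ε) hcard.le
      simp only [φ] at this ⊢
      linarith
    linarith
  obtain ⟨k, -, hk⟩ := Finset.exists_le_of_sum_le Finset.univ_nonempty htotal
  exact ⟨θ' k, k, hk⟩

/-- **Contraction principle** for Rademacher averages: if the increments of `g i` are bounded by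
the sum over `κ` of the increments of the `f i k`, then a Rademacher sum of the `g i` is dominated
by a Rademacher sum of functions `|κ| • f i (k i)`, up to the choice of the parameters. -/
lemma exists_selection_le {Θ κ : Type*} [Fintype κ] [Nonempty κ] (g : ι → Θ → ℝ)
    (f : ι → κ → Θ → ℝ) (hgf : ∀ i a b, |g i a - g i b| ≤ ∑ k, |f i k a - f i k b|)
    (θ : (ι → Bool) → Θ) :
    ∃ (θ' : (ι → Bool) → Θ) (k : ι → κ), ∑ ε, ∑ i, sgn (ε i) * g i (θ ε) ≤
      ∑ ε, ∑ i, sgn (ε i) * (Fintype.card κ * f i (k i) (θ' ε)) := by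
  classical
  suffices h : ∀ s : Finset ι, ∃ (θ' : (ι → Bool) → Θ) (k : ι → κ),
      ∑ ε, ∑ i, sgn (ε i) * g i (θ ε) ≤ ∑ ε, ∑ i, sgn (ε i) *
        (if i ∈ s then Fintype.card κ * f i (k i) (θ' ε) else g i (θ' ε)) by
    simpa using h Finset.univ
  intro s
  induction s using Finset.induction_on with
  | empty => exact ⟨θ, fun _ => Classical.arbitrary κ, by simp⟩
  | insert i s hi ih =>
    obtain ⟨θ₁, k₁, h₁⟩ := ih
    let A : (ι → Bool) → Θ → ℝ := fun ε a => ∑ l ∈ Finset.univ.erase i, sgn (ε l) *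
      (if l ∈ s then Fintype.card κ * f l (k₁ l) a else g l a)
    have hA : ∀ ε, A (flipAt i ε) = A ε := by
      intro ε
      funext a
      refine Finset.sum_congr rfl fun l hl => ?_
      rw [flipAt_of_ne (Finset.ne_of_mem_erase hl)]
    obtain ⟨θ₂, k, h₂⟩ := exists_selection_le_single i A hA (g i) (f i) (hgf i) θ₁
    refine ⟨θ₂, Function.update k₁ i k, h₁.trans ?_⟩
    refine (Eq.le ?_).trans (h₂.trans (Eq.le ?_))
    · refine Finset.sum_congr rfl fun ε _ => ?_
      rw [← Finset.sum_erase_add _ _ (Finset.mem_univ i)]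
      simp [A, hi]
    · refine Finset.sum_congr rfl fun ε _ => ?_
      rw [← Finset.sum_erase_add _ _ (Finset.mem_univ i)]
      congr 1
      · refine Finset.sum_congr rfl fun l hl => ?_
        have := Finset.ne_of_mem_erase hl
        simp [this]
      · simp

/-- The contraction principle in the scalar case. -/
lemma exists_selection_le_scalar {Θ : Type*} (g f : ι → Θ → ℝ)
    (hgf : ∀ i a b, |g i a - g i b| ≤ |f i a - f i b|) (θ : (ι → Bool) → Θ) :
    ∃ θ' : (ι → Bool) → Θ, ∑ ε, ∑ i, sgn (ε i) * g i (θ ε) ≤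
      ∑ ε, ∑ i, sgn (ε i) * f i (θ' ε) := by
  obtain ⟨θ', k, h⟩ := exists_selection_le (κ := Unit) g (fun i _ => f i)
    (by simpa using hgf) θ
  exact ⟨θ', by simpa using h⟩

/-- A Rademacher sum of fixed vectors. -/
lemma sum_norm_sum_sgn_smul_le {E : Type*} [NormedAddCommGroup E] [InnerProductSpace ℝ E]
    (v : ι → E) {b : ℝ} (hb : 0 ≤ b) (hv : ∀ i, ‖v i‖ ≤ b) :
    ∑ ε : ι → Bool, ‖∑ i, sgn (ε i) • v i‖ ≤
      Fintype.card (ι → Bool) * (b * √(Fintype.card ι)) := by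
  classical
  have hsq : ∑ ε : ι → Bool, ‖∑ i, sgn (ε i) • v i‖ ^ 2 ≤
      Fintype.card (ι → Bool) * (b ^ 2 * Fintype.card ι) := by
    have : ∀ ε : ι → Bool, ‖∑ i, sgn (ε i) • v i‖ ^ 2 =
        ∑ i, ∑ j, sgn (ε i) * sgn (ε j) * inner ℝ (v i) (v j) := by
      intro ε
      rw [← real_inner_self_eq_norm_sq, sum_inner]
      refine Finset.sum_congr rfl fun i _ => ?_
      rw [inner_sum]
      refine Finset.sum_congr rfl fun j _ => ?_
      rw [real_inner_smul_left, real_inner_smul_right]; ring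
    simp only [this]
    rw [Finset.sum_comm]
    have h2 : ∀ i, ∑ ε : ι → Bool, ∑ j, sgn (ε i) * sgn (ε j) * inner ℝ (v i) (v j) =
        Fintype.card (ι → Bool) * ‖v i‖ ^ 2 := by
      intro i
      rw [Finset.sum_comm, Finset.sum_eq_single i]
      · simp [sgn_mul_self]
      · intro j _ hj
        rw [← Finset.sum_mul, sum_sgn_mul_sgn hj.symm, zero_mul]
      · simp
    simp only [h2, ← Finset.mul_sum]
    refine mul_le_mul_of_nonneg_left ?_ (by positivity)
    calc ∑ i, ‖v i‖ ^ 2 ≤ ∑ _i : ι, b ^ 2 := by gcongr; exact hv _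
      _ = b ^ 2 * Fintype.card ι := by simp [mul_comm]
  -- Cauchy–Schwarz over the sign patterns passes from the first moment to the second.
  have hcs := sq_sum_le_card_mul_sum_sq (s := (Finset.univ : Finset (ι → Bool)))
    (f := fun ε => ‖∑ i, sgn (ε i) • v i‖)
  refine abs_le_of_sq_le_sq' ?_ (by positivity) |>.2
  refine hcs.trans ?_
  rw [Finset.card_univ, mul_pow, mul_pow, Real.sq_sqrt (by positivity), sq, mul_assoc]
  exact mul_le_mul_of_nonneg_left hsq (by positivity)

end Signs

/-! ### The bounded differences inequality -/

section BoundedDifferences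

open scoped NNReal

variable {Ω : Type*} [MeasurableSpace Ω]

lemma integral_pi_succ (D : Measure Ω) [IsProbabilityMeasure D] {n : ℕ}
    {G : (Fin (n + 1) → Ω) → ℝ} (hG : Integrable G (Measure.pi fun _ => D)) :
    ∫ S, G S ∂(Measure.pi fun _ => D) =
      ∫ x, ∫ y, G (Fin.cons x y) ∂(Measure.pi fun _ : Fin n => D) ∂D := by
  have mp := (measurePreserving_piFinSuccAbove (fun _ : Fin (n + 1) => D) 0).symm
  have h := mp.integral_comp' G
  have hint := (mp.integrable_comp_emb (MeasurableEquiv.measurableEmbedding _)).2 hG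
  rw [← h]
  refine (integral_prod _ hint).trans ?_
  simp [MeasurableEquiv.piFinSuccAbove, Fin.insertNthEquiv]

/-- **McDiarmid's inequality** in its sub-Gaussian form. -/
theorem hasSubgaussianMGF_of_bounded_differences (D : Measure Ω) [IsProbabilityMeasure D]
    (c : ℝ≥0) {a b : ℝ} {n : ℕ} {F : (Fin n → Ω) → ℝ} (hF : Measurable F)
    (hab : ∀ S, F S ∈ Set.Icc a b) (hdiff : ∀ S i z, |F (Function.update S i z) - F S| ≤ c) :
    HasSubgaussianMGF (fun S => F S - ∫ S', F S' ∂(Measure.pi fun _ => D)) (n * (c / 2) ^ 2)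
      (Measure.pi fun _ : Fin n => D) := by
  induction n with
  | zero =>
    have : (fun S => F S - ∫ S', F S' ∂(Measure.pi fun _ => D)) = fun _ => 0 := by
      funext S
      have : F = fun _ => F S := by funext S'; rw [Subsingleton.elim S' S]
      rw [this]; simp
    rw [this]
    simp
  | succ n ih =>
    have hmC : Measurable fun q : Ω × (Fin n → Ω) => (Fin.cons q.1 q.2 : Fin (n + 1) → Ω) := by
      refine measurable_pi_lambda _ fun i => ?_
      refine Fin.cases ?_ (fun i => ?_) i
      · exact measurable_fst
      · exact (measurable_pi_apply i).comp measurable_snd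
    have hFint : Integrable F (Measure.pi fun _ => D) :=
      Integrable.of_mem_Icc a b hF.aemeasurable (.of_forall hab)
    -- The conditional mean given the first coordinate: `F - E F` splits into `F - G`, covered by
    -- induction on each fibre, and `G - E G`, covered by Hoeffding's lemma.
    let G : Ω → ℝ := fun x => ∫ y, F (Fin.cons x y) ∂(Measure.pi fun _ : Fin n => D)
    have hFx : ∀ x, Measurable fun y : Fin n → Ω => F (Fin.cons x y) := fun x =>
      hF.comp (hmC.comp measurable_prodMk_left)
    have hFxint : ∀ x, Integrable (fun y : Fin n → Ω => F (Fin.cons x y))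
        (Measure.pi fun _ : Fin n => D) := fun x =>
      Integrable.of_mem_Icc a b (hFx x).aemeasurable (.of_forall fun y => hab _)
    have hGmeas : Measurable G :=
      (StronglyMeasurable.integral_prod_right (f := fun x (y : Fin n → Ω) => F (Fin.cons x y))
        (hF.comp hmC).stronglyMeasurable).measurable
    have hEG : ∫ S, F S ∂(Measure.pi fun _ => D) = ∫ x, G x ∂D := integral_pi_succ D hFint
    have hGdiff : ∀ x x', G x - c ≤ G x' := by
      intro x x'
      have : G x - G x' = ∫ y, (F (Fin.cons x y) - F (Fin.cons x' y))
          ∂(Measure.pi fun _ : Fin n => D) := (integral_sub (hFxint x) (hFxint x')).symm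
      have h2 : G x - G x' ≤ ∫ _y : Fin n → Ω, (c : ℝ) ∂(Measure.pi fun _ : Fin n => D) := by
        rw [this]
        refine integral_mono ((hFxint x).sub (hFxint x')) (integrable_const _) fun y => ?_
        have h3 := hdiff (Fin.cons x' y) 0 x
        rw [Fin.update_cons_zero] at h3
        exact (le_abs_self _).trans h3
      simp at h2
      linarith
    have hGa : ∀ x, a ≤ G x := fun x => by
      have := integral_mono (μ := Measure.pi fun _ : Fin n => D) (integrable_const a) (hFxint x)
        fun y => (hab _).1
      simpa using this
    have hne : Nonempty Ω := nonempty_of_isProbabilityMeasure D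
    have hbdd : BddBelow (Set.range G) := ⟨a, by rintro _ ⟨x, rfl⟩; exact hGa x⟩
    -- Anchoring the interval at the infimum gives it width exactly `c`; the bounds `a`, `b` serve
    -- only integrability and boundedness.
    have hGIcc : ∀ x, G x ∈ Set.Icc (⨅ x, G x) ((⨅ x, G x) + c) := fun x =>
      ⟨ciInf_le hbdd x, by have := le_ciInf fun x' => hGdiff x x'; linarith⟩
    have hsubG := hasSubgaussianMGF_of_mem_Icc (μ := D) hGmeas.aemeasurable (.of_forall hGIcc)
    have hsubF : ∀ x, HasSubgaussianMGF (fun y => F (Fin.cons x y) - G x) (n * (c / 2) ^ 2)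
        (Measure.pi fun _ : Fin n => D) := fun x =>
      ih (hFx x) (fun y => hab _) fun S i z => by
        have := hdiff (Fin.cons x S) i.succ z
        rwa [← Fin.cons_update] at this
    have hexp : ∀ t, Integrable
        (fun S => Real.exp (t * (F S - ∫ S', F S' ∂(Measure.pi fun _ => D))))
        (Measure.pi fun _ : Fin (n + 1) => D) := fun t =>
      integrable_exp_mul_of_mem_Icc (a := a - ∫ S', F S' ∂(Measure.pi fun _ => D))
        (b := b - ∫ S', F S' ∂(Measure.pi fun _ => D)) (hF.sub_const _).aemeasurable
        (.of_forall fun S => ⟨sub_le_sub_right (hab S).1 _, sub_le_sub_right (hab S).2 _⟩)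
    refine ⟨hexp, fun t => ?_⟩
    rw [mgf, integral_pi_succ D (hexp t), hEG]
    have hinner : ∀ x, ∫ y, Real.exp (t * (F (Fin.cons x y) - ∫ x, G x ∂D))
        ∂(Measure.pi fun _ : Fin n => D) ≤
        Real.exp (t * (G x - ∫ x, G x ∂D)) * Real.exp ((n * (c / 2) ^ 2) * t ^ 2 / 2) := by
      intro x
      have : ∀ y, Real.exp (t * (F (Fin.cons x y) - ∫ x, G x ∂D)) =
          Real.exp (t * (G x - ∫ x, G x ∂D)) * Real.exp (t * (F (Fin.cons x y) - G x)) := by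
        intro y; rw [← Real.exp_add]; congr 1; ring
      simp only [this]
      rw [integral_const_mul]
      refine mul_le_mul_of_nonneg_left ?_ (Real.exp_pos _).le
      simpa [mgf] using (hsubF x).mgf_le t
    calc _ ≤ ∫ x, Real.exp (t * (G x - ∫ x, G x ∂D)) *
          Real.exp ((n * (c / 2) ^ 2) * t ^ 2 / 2) ∂D := by
          refine integral_mono_of_nonneg (.of_forall fun x => integral_nonneg fun y =>
            (Real.exp_pos _).le) ((hsubG.integrable_exp_mul t).mul_const _) (.of_forall hinner)
      _ ≤ Real.exp ((c / 2) ^ 2 * t ^ 2 / 2) * Real.exp ((n * (c / 2) ^ 2) * t ^ 2 / 2) := by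
          rw [integral_mul_const]
          refine mul_le_mul_of_nonneg_right ?_ (Real.exp_pos _).le
          simpa [mgf] using hsubG.mgf_le t
      _ = _ := by
          rw [← Real.exp_add]; congr 1; push_cast; ring

end BoundedDifferences

/-! ### Uniform convergence -/

section UniformConvergence

variable {Z : Type*} [MeasurableSpace Z]

/-- Suprema of uniformly close finite families are close. -/
lemma abs_sup'_sub_sup'_le {κ : Type*} {s : Finset κ} (hs : s.Nonempty) {f g : κ → ℝ} {c : ℝ}
    (h : ∀ k ∈ s, |f k - g k| ≤ c) : |s.sup' hs f - s.sup' hs g| ≤ c := by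
  rw [abs_sub_le_iff]
  constructor
  · rw [sub_le_iff_le_add]
    refine Finset.sup'_le _ _ fun k hk => ?_
    have := (abs_sub_le_iff.1 (h k hk)).1
    have := Finset.le_sup' g hk
    linarith
  · rw [sub_le_iff_le_add]
    refine Finset.sup'_le _ _ fun k hk => ?_
    have := (abs_sub_le_iff.1 (h k hk)).2
    have := Finset.le_sup' f hk
    linarith

lemma measurable_sup'_apply {κ Ω : Type*} [MeasurableSpace Ω] {s : Finset κ} (hs : s.Nonempty)
    {f : κ → Ω → ℝ} (hf : ∀ k, Measurable (f k)) :
    Measurable fun x => s.sup' hs fun k => f k x := by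
  have := Finset.measurable_sup' hs (f := f) fun k _ => hf k
  convert this using 1
  funext x
  simp [Finset.sup'_apply]

lemma sup'_mem_Icc {κ : Type*} {s : Finset κ} (hs : s.Nonempty) {f : κ → ℝ} {a b : ℝ}
    (h : ∀ k, f k ∈ Set.Icc a b) : s.sup' hs f ∈ Set.Icc a b := by
  refine ⟨?_, Finset.sup'_le _ _ fun k _ => (h k).2⟩
  obtain ⟨k, hk⟩ := hs
  exact (h k).1.trans (Finset.le_sup' f hk)

lemma sum_sub_mem_Icc {n : ℕ} {M : ℝ} {x y : Fin n → ℝ} (hx : ∀ i, x i ∈ Set.Icc 0 M)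
    (hy : ∀ i, y i ∈ Set.Icc 0 M) : ∑ i, (x i - y i) ∈ Set.Icc (-(n * M)) (n * M) := by
  refine abs_le.1 ((Finset.abs_sum_le_sum_abs _ _).trans ?_)
  refine (Finset.sum_le_card_nsmul _ _ M fun i _ => ?_).trans_eq (by simp)
  rw [abs_le]
  exact ⟨by linarith [(hx i).1, (hy i).2], by linarith [(hx i).2, (hy i).1]⟩

lemma integral_mem_Icc {D : Measure Z} [IsProbabilityMeasure D] {M : ℝ} {f : Z → ℝ}
    (hf : Measurable f) (hfM : ∀ z, f z ∈ Set.Icc 0 M) : ∫ z, f z ∂D ∈ Set.Icc 0 M := by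
  refine ⟨integral_nonneg fun z => (hfM z).1, ?_⟩
  have hint : Integrable f D := Integrable.of_mem_Icc 0 M hf.aemeasurable (.of_forall hfM)
  simpa using integral_mono hint (integrable_const M) fun z => (hfM z).2

/-- Introduction of a ghost sample. -/
lemma integral_sup'_deviation_le_ghost {κ : Type*} {s : Finset κ} (hs : s.Nonempty)
    (D : Measure Z) [IsProbabilityMeasure D] {n : ℕ} {M : ℝ} {ℓ : κ → Z → ℝ}
    (hℓ : ∀ k, Measurable (ℓ k)) (hℓM : ∀ k z, ℓ k z ∈ Set.Icc 0 M) :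
    ∫ S, s.sup' hs (fun k => ∑ i, (∫ z, ℓ k z ∂D - ℓ k (S i))) ∂(Measure.pi fun _ : Fin n => D)
      ≤ ∫ u, s.sup' hs (fun k => ∑ i, (ℓ k (u i).1 - ℓ k (u i).2))
        ∂(Measure.pi fun _ : Fin n => D.prod D) := by
  have hint : ∀ k, Integrable (ℓ k) D := fun k =>
    Integrable.of_mem_Icc 0 M (hℓ k).aemeasurable (.of_forall (hℓM k))
  have mp := (measurePreserving_arrowProdEquivProdArrow Z Z (Fin n) (fun _ => D) (fun _ => D)).symm
  have hm : Measurable fun v : (Fin n → Z) × (Fin n → Z) =>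
      s.sup' hs (fun k => ∑ i, (ℓ k (v.1 i) - ℓ k (v.2 i))) := by
    refine measurable_sup'_apply hs fun k => Finset.measurable_fun_sum _ fun i _ => ?_
    exact ((hℓ k).comp ((measurable_pi_apply i).comp measurable_fst)).sub
      ((hℓ k).comp ((measurable_pi_apply i).comp measurable_snd))
  have hb : ∀ S S' : Fin n → Z, s.sup' hs (fun k => ∑ i, (ℓ k (S i) - ℓ k (S' i))) ∈
      Set.Icc (-(n * M)) (n * M) := fun S S' =>
    sup'_mem_Icc hs fun k => sum_sub_mem_Icc (fun i => hℓM k _) fun i => hℓM k _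
  have hint' : Integrable (fun v : (Fin n → Z) × (Fin n → Z) =>
      s.sup' hs (fun k => ∑ i, (ℓ k (v.1 i) - ℓ k (v.2 i))))
      ((Measure.pi fun _ => D).prod (Measure.pi fun _ => D)) :=
    Integrable.of_mem_Icc _ _ hm.aemeasurable (.of_forall fun v => hb v.1 v.2)
  -- The true mean is an average over a second sample, and a supremum of averages is at most the
  -- average of the supremum.
  have hmono : ∀ S' : Fin n → Z, s.sup' hs (fun k => ∑ i, (∫ z, ℓ k z ∂D - ℓ k (S' i))) ≤
      ∫ S, s.sup' hs (fun k => ∑ i, (ℓ k (S i) - ℓ k (S' i))) ∂(Measure.pi fun _ => D) := by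
    intro S'
    refine Finset.sup'_le _ _ fun k hk => ?_
    have he : ∀ i, Integrable (fun S : Fin n → Z => ℓ k (S i)) (Measure.pi fun _ => D) := fun i =>
      (measurePreserving_eval (fun _ : Fin n => D) i).integrable_comp_of_integrable (hint k)
    have hi : ∀ i, Integrable (fun S : Fin n → Z => ℓ k (S i) - ℓ k (S' i))
        (Measure.pi fun _ => D) := fun i => (he i).sub (integrable_const _)
    have : ∑ i, (∫ z, ℓ k z ∂D - ℓ k (S' i)) =
        ∫ S, ∑ i, (ℓ k (S i) - ℓ k (S' i)) ∂(Measure.pi fun _ => D) := by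
      rw [integral_finsetSum _ fun i _ => hi i]
      refine Finset.sum_congr rfl fun i _ => ?_
      rw [integral_sub (he i) (integrable_const _), integral_comp_eval (μ := fun _ : Fin n => D)
        (i := i) (f := ℓ k) (hℓ k).aestronglyMeasurable]
      simp
    rw [this]
    refine integral_mono (integrable_finsetSum _ fun i _ => hi i) ?_ fun S =>
      Finset.le_sup' (fun k => ∑ i, (ℓ k (S i) - ℓ k (S' i))) hk
    refine Integrable.of_mem_Icc (-(n * M)) (n * M) (Measurable.aemeasurable ?_)
      (.of_forall fun S => hb S S')
    exact measurable_sup'_apply hs fun k => Finset.measurable_fun_sum _ fun i _ =>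
      ((hℓ k).comp (measurable_pi_apply i)).sub measurable_const
  calc _ ≤ ∫ S', ∫ S, s.sup' hs (fun k => ∑ i, (ℓ k (S i) - ℓ k (S' i)))
          ∂(Measure.pi fun _ => D) ∂(Measure.pi fun _ => D) := by
        refine integral_mono ?_ hint'.integral_prod_right hmono
        refine Integrable.of_mem_Icc (-(n * M)) (n * M) (Measurable.aemeasurable ?_)
          (.of_forall fun S => ?_)
        · exact measurable_sup'_apply hs fun k => Finset.measurable_fun_sum _ fun i _ =>
            measurable_const.sub ((hℓ k).comp (measurable_pi_apply i))
        · exact sup'_mem_Icc hs fun k => sum_sub_mem_Icc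
            (fun i => integral_mem_Icc (hℓ k) (hℓM k)) fun i => hℓM k _
    _ = _ := (integral_prod_symm _ hint').symm
    _ = _ := mp.integral_comp' fun u : Fin n → Z × Z =>
        s.sup' hs (fun k => ∑ i, (ℓ k (u i).1 - ℓ k (u i).2))

/-- **Symmetrization**: the expected worst deviation over a finite family is at most twice the
Rademacher average. -/
lemma integral_sup'_deviation_le {κ : Type*} {s : Finset κ} (hs : s.Nonempty)
    (D : Measure Z) [IsProbabilityMeasure D] {n : ℕ} {M ρ : ℝ} {ℓ : κ → Z → ℝ}
    (hℓ : ∀ k, Measurable (ℓ k)) (hℓM : ∀ k z, ℓ k z ∈ Set.Icc 0 M)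
    (hρ : ∀ (S : Fin n → Z) (θ : (Fin n → Bool) → κ),
      ∑ ε, ∑ i, sgn (ε i) * ℓ (θ ε) (S i) ≤ Fintype.card (Fin n → Bool) * ρ) :
    ∫ S, s.sup' hs (fun k => ∑ i, (∫ z, ℓ k z ∂D - ℓ k (S i))) ∂(Measure.pi fun _ : Fin n => D)
      ≤ 2 * ρ := by
  refine (integral_sup'_deviation_le_ghost hs D hℓ hℓM).trans ?_
  set H : (Fin n → Z × Z) → ℝ := fun u => s.sup' hs fun k => ∑ i, (ℓ k (u i).1 - ℓ k (u i).2)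
    with hH
  have hHmeas : Measurable H := by
    refine measurable_sup'_apply hs fun k => Finset.measurable_fun_sum _ fun i _ => ?_
    exact ((hℓ k).comp (measurable_fst.comp (measurable_pi_apply i))).sub
      ((hℓ k).comp (measurable_snd.comp (measurable_pi_apply i)))
  have hHint : Integrable H (Measure.pi fun _ : Fin n => D.prod D) :=
    Integrable.of_mem_Icc (-(n * M)) (n * M) hHmeas.aemeasurable (.of_forall fun u =>
      sup'_mem_Icc hs fun k => sum_sub_mem_Icc (fun i => hℓM k _) fun i => hℓM k _)
  -- Exchanging a point with its ghost preserves `D.prod D` and reverses the sign of the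
  -- corresponding difference.
  let sw : (Fin n → Bool) → (Fin n → Z × Z) → (Fin n → Z × Z) := fun ε u i =>
    if ε i then u i else (u i).swap
  have hsw : ∀ ε, MeasurePreserving (sw ε) (Measure.pi fun _ : Fin n => D.prod D)
      (Measure.pi fun _ : Fin n => D.prod D) := by
    intro ε
    refine measurePreserving_pi (fun _ => D.prod D) (fun _ => D.prod D)
      (f := fun i z => if ε i then z else z.swap) fun i => ?_
    cases ε i
    · simpa using Measure.measurePreserving_swap
    · simpa using! MeasurePreserving.id _
  have hswint : ∀ ε, Integrable (fun u => H (sw ε u)) (Measure.pi fun _ : Fin n => D.prod D) :=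
    fun ε => (hsw ε).integrable_comp_of_integrable hHint
  have hsum : (Fintype.card (Fin n → Bool) : ℝ) * ∫ u, H u ∂(Measure.pi fun _ => D.prod D) =
      ∫ u, ∑ ε, H (sw ε u) ∂(Measure.pi fun _ => D.prod D) := by
    rw [integral_finsetSum _ fun ε _ => hswint ε]
    have : ∀ ε, ∫ u, H (sw ε u) ∂(Measure.pi fun _ => D.prod D) =
        ∫ u, H u ∂(Measure.pi fun _ => D.prod D) := by
      intro ε
      conv_rhs => rw [← (hsw ε).map_eq]
      rw [integral_map (hsw ε).measurable.aemeasurable hHmeas.aestronglyMeasurable]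
    simp [this]
  have hpt : ∀ u, ∑ ε, H (sw ε u) ≤ Fintype.card (Fin n → Bool) * (2 * ρ) := by
    intro u
    have hex : ∀ ε, ∃ k, H (sw ε u) = ∑ i, sgn (ε i) * (ℓ k (u i).1 - ℓ k (u i).2) := by
      intro ε
      obtain ⟨k, -, hk⟩ := Finset.exists_mem_eq_sup' hs
        fun k => ∑ i, (ℓ k (sw ε u i).1 - ℓ k (sw ε u i).2)
      refine ⟨k, hk.trans (Finset.sum_congr rfl fun i _ => ?_)⟩
      simp only [sw]
      cases ε i <;> simp [sgn]
    choose θ hθ using hex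
    have h1 := hρ (fun i => (u i).1) θ
    -- The ghost half carries the signs `-sgn (ε i)`; reindexing by the global negation turns it
    -- into another instance of `hρ`, hence `2 * ρ`.
    have h2 := hρ (fun i => (u i).2) fun ε => θ fun i => !ε i
    rw [← sum_not] at h2
    simp only [Bool.not_not, sgn_not] at h2
    calc ∑ ε, H (sw ε u) = ∑ ε, ∑ i, sgn (ε i) * ℓ (θ ε) (u i).1 +
          ∑ ε, ∑ i, -sgn (ε i) * ℓ (θ ε) (u i).2 := by
          rw [← Finset.sum_add_distrib]
          refine Finset.sum_congr rfl fun ε _ => ?_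
          rw [hθ, ← Finset.sum_add_distrib]
          refine Finset.sum_congr rfl fun i _ => by ring
      _ ≤ _ := by linarith
  have hcard : (0 : ℝ) < Fintype.card (Fin n → Bool) := by exact_mod_cast Fintype.card_pos
  refine le_of_mul_le_mul_left ?_ hcard
  rw [hsum]
  have := integral_mono (μ := Measure.pi fun _ : Fin n => D.prod D)
    (integrable_finsetSum _ fun ε _ => hswint ε) (integrable_const _) hpt
  simpa using this

/-- Uniform convergence over a finite family in terms of its Rademacher average. -/
lemma measureReal_sup'_deviation_ge_le {κ : Type*} {s : Finset κ} (hs : s.Nonempty)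
    (D : Measure Z) [IsProbabilityMeasure D] {n : ℕ} {M ρ : ℝ} {ℓ : κ → Z → ℝ}
    (hℓ : ∀ k, Measurable (ℓ k)) (hℓM : ∀ k z, ℓ k z ∈ Set.Icc 0 M)
    (hρ : ∀ (S : Fin n → Z) (θ : (Fin n → Bool) → κ),
      ∑ ε, ∑ i, sgn (ε i) * ℓ (θ ε) (S i) ≤ Fintype.card (Fin n → Bool) * ρ)
    {t : ℝ} (ht : 0 ≤ t) :
    (Measure.pi fun _ : Fin n => D).real
      {S | 2 * ρ + t ≤ s.sup' hs (fun k => ∑ i, (∫ z, ℓ k z ∂D - ℓ k (S i)))} ≤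
      Real.exp (-(2 * t ^ 2 / (n * M ^ 2))) := by
  have hM : 0 ≤ M := by
    obtain ⟨k, -⟩ := hs
    obtain ⟨z⟩ := nonempty_of_isProbabilityMeasure D
    exact (hℓM k z).1.trans (hℓM k z).2
  let F : (Fin n → Z) → ℝ := fun S => s.sup' hs (fun k => ∑ i, (∫ z, ℓ k z ∂D - ℓ k (S i)))
  have hF : Measurable F := measurable_sup'_apply hs fun k => Finset.measurable_fun_sum _ fun i _ =>
    measurable_const.sub ((hℓ k).comp (measurable_pi_apply i))
  have hFb : ∀ S, F S ∈ Set.Icc (-(n * M)) (n * M) := fun S =>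
    sup'_mem_Icc hs fun k => sum_sub_mem_Icc (fun i => integral_mem_Icc (hℓ k) (hℓM k))
      fun i => hℓM k _
  have hdiff : ∀ S i z, |F (Function.update S i z) - F S| ≤ (⟨M, hM⟩ : NNReal) := by
    intro S i z
    refine abs_sup'_sub_sup'_le hs fun k _ => ?_
    rw [← Finset.sum_sub_distrib, Finset.sum_eq_single i]
    · have h1 := hℓM k (S i)
      have h2 := hℓM k z
      simp only [Function.update_self]
      rw [abs_le]
      exact ⟨by linarith [h1.1, h2.2], by linarith [h1.2, h2.1]⟩
    · intro j _ hj
      simp [Function.update_of_ne hj]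
    · simp
  have hsub := hasSubgaussianMGF_of_bounded_differences D ⟨M, hM⟩ hF hFb hdiff
  have hmean := integral_sup'_deviation_le hs D hℓ hℓM hρ
  refine (measureReal_mono ?_).trans ((hsub.measure_ge_le ht).trans_eq ?_)
  · intro S hS
    simp only [Set.mem_ofPred_eq] at hS ⊢
    change 2 * ρ + t ≤ F S at hS
    change ∫ S, F S ∂_ ≤ _ at hmean
    linarith
  · congr 1
    push_cast
    rw [neg_div]
    congr 1
    -- In the degenerate case both quotients are divisions by zero, so the bound reads `exp 0`.
    by_cases h : (n : ℝ) * M ^ 2 = 0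
    · have : 2 * ((n : ℝ) * (M / 2) ^ 2) = 0 := by linarith [show 2 * ((n : ℝ) * (M / 2) ^ 2) = n * M ^ 2 / 2 by ring]
      change t ^ 2 / (2 * ((n : ℝ) * (M / 2) ^ 2)) = _
      rw [this, h, div_zero, div_zero]
    · change t ^ 2 / (2 * ((n : ℝ) * (M / 2) ^ 2)) = _
      rw [show 2 * ((n : ℝ) * (M / 2) ^ 2) = n * M ^ 2 / 2 by ring]
      field_simp

/-- **Uniform convergence** over a separable class in terms of its Rademacher average. -/
theorem measure_exists_deviation_gt_le {Θ : Type*} [TopologicalSpace Θ]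
    [FirstCountableTopology Θ]
    [TopologicalSpace.SeparableSpace Θ] (D : Measure Z) [IsProbabilityMeasure D] {n : ℕ}
    {M ρ : ℝ} {ℓ : Θ → Z → ℝ} (hℓ : ∀ θ, Measurable (ℓ θ))
    (hcont : ∀ z, Continuous fun θ => ℓ θ z) (hℓM : ∀ θ z, ℓ θ z ∈ Set.Icc 0 M)
    (hρ : ∀ (S : Fin n → Z) (θ : (Fin n → Bool) → Θ),
      ∑ ε, ∑ i, sgn (ε i) * ℓ (θ ε) (S i) ≤ Fintype.card (Fin n → Bool) * ρ)
    {t : ℝ} (ht : 0 ≤ t) :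
    (Measure.pi fun _ : Fin n => D)
      {S | ∃ θ, 2 * ρ + t < ∑ i, (∫ z, ℓ θ z ∂D - ℓ θ (S i))} ≤
      ENNReal.ofReal (Real.exp (-(2 * t ^ 2 / (n * M ^ 2)))) := by
  cases isEmpty_or_nonempty Θ
  · simp
  have hRcont : Continuous fun θ => ∫ z, ℓ θ z ∂D := by
    refine continuous_of_dominated (bound := fun _ => M) (fun θ => (hℓ θ).aestronglyMeasurable)
      (fun θ => .of_forall fun z => ?_) (integrable_const M) (.of_forall hcont)
    rw [Real.norm_of_nonneg (hℓM θ z).1]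
    exact (hℓM θ z).2
  let d := TopologicalSpace.denseSeq Θ
  let A : ℕ → Set (Fin n → Z) := fun N => {S | 2 * ρ + t ≤ (Finset.range (N + 1)).sup'
    Finset.nonempty_range_add_one fun k => ∑ i, (∫ z, ℓ (d k) z ∂D - ℓ (d k) (S i))}
  have hAmono : Monotone A := by
    intro N N' h S hS
    exact le_trans (α := ℝ) hS (Finset.sup'_mono _ (Finset.range_mono (by omega)) _)
  -- Strictness makes the set of violating parameters open, so it meets the dense sequence. The sets
  -- `A N` increase, so their union costs no more than a single finite family.
  have hsub : {S | ∃ θ, 2 * ρ + t < ∑ i, (∫ z, ℓ θ z ∂D - ℓ θ (S i))} ⊆ ⋃ N, A N := by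
    rintro S ⟨θ, hθ⟩
    have hc : Continuous fun θ => ∑ i, (∫ z, ℓ θ z ∂D - ℓ θ (S i)) :=
      continuous_finsetSum _ fun i _ => hRcont.sub (hcont (S i))
    obtain ⟨N, hx⟩ := (TopologicalSpace.denseRange_denseSeq Θ).exists_mem_open
      (isOpen_lt continuous_const hc) ⟨θ, hθ⟩
    exact Set.mem_iUnion.2 ⟨N, (le_of_lt hx).trans (Finset.le_sup'
      (fun k => ∑ i, (∫ z, ℓ (d k) z ∂D - ℓ (d k) (S i))) (Finset.self_mem_range_succ _))⟩
  refine (measure_mono hsub).trans ?_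
  rw [hAmono.measure_iUnion]
  refine iSup_le fun N => ?_
  rw [← ENNReal.ofReal_toReal (measure_ne_top (Measure.pi fun _ : Fin n => D) (A N))]
  refine ENNReal.ofReal_le_ofReal ?_
  exact measureReal_sup'_deviation_ge_le (ℓ := fun k => ℓ (d k)) _ D (fun k => hℓ _)
    (fun k => hℓM _) (fun S θ => hρ S fun ε => d (θ ε)) ht

end UniformConvergence

/-! ### The PAC-Bayes bound -/

section PACBayes

variable {Z H : Type*} [MeasurableSpace Z] [MeasurableSpace H]

/-- Hoeffding's inequality for a sum of independent copies of a bounded function. -/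
lemma measureReal_deviation_ge_le (D : Measure Z) [IsProbabilityMeasure D] {n : ℕ} {M : ℝ}
    {f : Z → ℝ} (hf : Measurable f) (hfM : ∀ z, f z ∈ Set.Icc 0 M) {t : ℝ} (ht : 0 ≤ t) :
    (Measure.pi fun _ : Fin n => D).real {S | t ≤ ∑ i, (∫ z, f z ∂D - f (S i))} ≤
      Real.exp (-(2 * t ^ 2 / (n * M ^ 2))) := by
  -- A one-element family has Rademacher average zero, by reversing all signs.
  have h := measureReal_sup'_deviation_ge_le (s := {()}) (Finset.singleton_nonempty ()) D (n := n)
    (ρ := 0) (ℓ := fun _ => f) (fun _ => hf) (fun _ => hfM) (fun S θ => ?_) ht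
  · simpa using h
  · rw [Finset.sum_comm, mul_zero]
    refine (Finset.sum_eq_zero fun i _ => ?_).le
    have := sum_not (fun ε : Fin n → Bool => sgn (ε i) * f (S i))
    simp only [sgn_not, neg_mul, Finset.sum_neg_distrib] at this
    linarith

/-- The exponential moment of the squared one-sided deviation. -/
lemma lintegral_exp_sq_deviation_le (D : Measure Z) [IsProbabilityMeasure D] {n : ℕ} (hn : 2 ≤ n)
    {M : ℝ} (hM : 0 < M) {f : Z → ℝ} (hf : Measurable f) (hfM : ∀ z, f z ∈ Set.Icc 0 M) :
    ∫⁻ S, ENNReal.ofReal (Real.exp (2 * (n - 1) / (n ^ 2 * M ^ 2) *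
      (max (∑ i, (∫ z, f z ∂D - f (S i))) 0) ^ 2)) ∂(Measure.pi fun _ : Fin n => D) ≤ n := by
  have hn1 : (0 : ℝ) < n - 1 := by
    have : (2 : ℝ) ≤ n := by exact_mod_cast hn
    linarith
  have hn0 : (0 : ℝ) < n := by linarith
  -- At the critical rate `2 / (n M ^ 2)` the tail bound would be `x⁻¹`, not integrable at infinity.
  -- The factor `(n - 1) / n` turns it into `x ^ (-n / (n - 1))`, with integral `n - 1` over `(1,
  -- ∞)`; the interval `(0, 1]` adds at most `1`.
  set a : ℝ := 2 * (n - 1) / (n ^ 2 * M ^ 2) with ha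
  have ha0 : 0 < a := by positivity
  have hmeas : Measurable fun S : Fin n → Z => ∑ i, (∫ z, f z ∂D - f (S i)) :=
    Finset.measurable_fun_sum _ fun i _ => measurable_const.sub (hf.comp (measurable_pi_apply i))
  have hmeas' : Measurable fun S : Fin n → Z =>
      Real.exp (a * (max (∑ i, (∫ z, f z ∂D - f (S i))) 0) ^ 2) :=
    Real.measurable_exp.comp (((hmeas.max measurable_const).pow_const 2).const_mul a)
  rw [lintegral_eq_lintegral_meas_le _ (.of_forall fun S => (Real.exp_pos _).le)
    hmeas'.aemeasurable]
  have hsplit : Set.Ioi (0 : ℝ) = Set.Ioc 0 1 ∪ Set.Ioi 1 := by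
    rw [Set.Ioc_union_Ioi_eq_Ioi zero_le_one]
  set p : ℝ := -(n / (n - 1)) with hp
  have hp1 : p < -1 := by
    rw [hp, neg_lt_neg_iff, one_lt_div hn1]; linarith
  have htail : ∀ x ∈ Set.Ioi (1 : ℝ), (Measure.pi fun _ : Fin n => D)
      {S | x ≤ Real.exp (a * (max (∑ i, (∫ z, f z ∂D - f (S i))) 0) ^ 2)} ≤
      ENNReal.ofReal (x ^ p) := by
    intro x hx
    have hx1 : 1 < x := hx
    have hx0 : 0 < x := by linarith
    have hlog : 0 < Real.log x := Real.log_pos hx1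
    rw [← ENNReal.ofReal_toReal (measure_ne_top (Measure.pi fun _ : Fin n => D) _)]
    refine ENNReal.ofReal_le_ofReal ((measureReal_mono ?_).trans
      ((measureReal_deviation_ge_le D hf hfM (Real.sqrt_nonneg (Real.log x / a))).trans_eq ?_))
    · intro S hS
      have h1 : x ≤ Real.exp (a * (max (∑ i, (∫ z, f z ∂D - f (S i))) 0) ^ 2) := hS
      have h2 := (Real.log_le_iff_le_exp hx0).2 h1
      have h3 : √(Real.log x / a) ≤ max (∑ i, (∫ z, f z ∂D - f (S i))) 0 := by
        refine Real.sqrt_le_iff.2 ⟨le_max_right _ _, ?_⟩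
        rw [div_le_iff₀ ha0]; linarith
      have h4 : 0 < √(Real.log x / a) := Real.sqrt_pos.2 (by positivity)
      rcases le_max_iff.1 h3 with h | h
      · exact h
      · linarith
    · rw [Real.sq_sqrt (by positivity), Real.rpow_def_of_pos hx0]
      congr 1
      rw [ha, hp]
      field_simp
  rw [hsplit]
  refine (lintegral_union_le _ _ _).trans ?_
  have h1 : ∫⁻ x in Set.Ioc (0 : ℝ) 1, (Measure.pi fun _ : Fin n => D)
      {S | x ≤ Real.exp (a * (max (∑ i, (∫ z, f z ∂D - f (S i))) 0) ^ 2)} ≤ 1 := by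
    refine (lintegral_mono fun x => prob_le_one).trans ?_
    simp
  have h2 : ∫⁻ x in Set.Ioi (1 : ℝ), (Measure.pi fun _ : Fin n => D)
      {S | x ≤ Real.exp (a * (max (∑ i, (∫ z, f z ∂D - f (S i))) 0) ^ 2)} ≤
      ENNReal.ofReal (n - 1) := by
    refine (setLIntegral_mono' measurableSet_Ioi htail).trans ?_
    rw [← ofReal_integral_eq_lintegral_ofReal (integrableOn_Ioi_rpow_of_lt hp1 one_pos)]
    · refine ENNReal.ofReal_le_ofReal (le_of_eq ?_)
      rw [integral_Ioi_rpow_of_lt hp1 one_pos, Real.one_rpow, hp]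
      have : -((n : ℝ) / (n - 1)) + 1 = -(1 / (n - 1)) := by field_simp; ring
      rw [this]; field_simp
    · refine (ae_restrict_mem measurableSet_Ioi).mono fun x hx => ?_
      have hx1 : (1 : ℝ) < x := hx
      exact Real.rpow_nonneg (by linarith) _
  refine (add_le_add h1 h2).trans_eq ?_
  rw [← ENNReal.ofReal_one, ← ENNReal.ofReal_add zero_le_one hn1.le]
  simp

/-- The **Donsker–Varadhan** inequality for bounded functions. -/
lemma integral_le_toReal_klDiv_add_log (Q P : Measure H) [IsProbabilityMeasure Q]
    [IsProbabilityMeasure P] (hQP : klDiv Q P ≠ ∞) {f : H → ℝ} (hf : Measurable f) {b : ℝ}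
    (hfb : ∀ T, f T ∈ Set.Icc 0 b) :
    ∫ T, f T ∂Q ≤ (klDiv Q P).toReal + Real.log (∫ T, Real.exp (f T) ∂P) := by
  obtain ⟨hac, hllr⟩ := klDiv_ne_top_iff.1 hQP
  have hfQ : Integrable f Q := Integrable.of_mem_Icc 0 b hf.aemeasurable (.of_forall hfb)
  have hexpP : Integrable (fun T => Real.exp (f T)) P := by
    simpa using integrable_exp_mul_of_mem_Icc (t := 1) hf.aemeasurable
      (.of_forall hfb : ∀ᵐ T ∂P, f T ∈ Set.Icc 0 b)
  -- The inequality is nonnegativity of the divergence from `Q` to the Gibbs measure `P.tilted f`,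
  -- expanded through its log-likelihood ratio.
  have hac' : Q ≪ P.tilted f := hac.trans (absolutelyContinuous_tilted hexpP)
  have : IsProbabilityMeasure (P.tilted f) := isProbabilityMeasure_tilted hexpP
  have h1 := integral_llr_tilted_right hac hfQ hexpP hllr
  have h2 := toReal_klDiv_of_measure_eq hac (by simp : Q Set.univ = P Set.univ)
  have h3 := toReal_klDiv_of_measure_eq hac' (by simp : Q Set.univ = (P.tilted f) Set.univ)
  have h4 : 0 ≤ (klDiv Q (P.tilted f)).toReal := ENNReal.toReal_nonneg
  linarith

/-- The PAC-Bayes argument for a fixed sample: an exponential moment under the prior controls the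
mean of `Δ` under all posteriors. -/
lemma integral_le_of_lintegral_exp_sq_lt (Q P : Measure H) [IsProbabilityMeasure Q]
    [IsProbabilityMeasure P] (hQ : klDiv Q P ≠ ∞) {n : ℝ} (hn : 1 < n) {M : ℝ} (hM : 0 < M)
    {δ : ℝ} (hδ : 0 < δ) {Δ : H → ℝ} (hΔ : Measurable Δ)
    (hΔb : ∀ T, Δ T ∈ Set.Icc (-(n * M)) (n * M))
    (hlt : ∫⁻ T, ENNReal.ofReal
      (Real.exp (2 * (n - 1) / (n ^ 2 * M ^ 2) * (max (Δ T) 0) ^ 2)) ∂P < ENNReal.ofReal (n / δ)) :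
    ∫ T, Δ T / n ∂Q ≤ M * √(((klDiv Q P).toReal + Real.log (n / δ)) / (2 * (n - 1))) := by
  have hn1 : 0 < n - 1 := by linarith
  have hn0 : 0 < n := by linarith
  set a : ℝ := 2 * (n - 1) / (n ^ 2 * M ^ 2) with ha
  have ha0 : 0 < a := by positivity
  let g : H → ℝ := fun T => a * (max (Δ T) 0) ^ 2
  have hg : Measurable g := ((hΔ.max measurable_const).pow_const 2).const_mul a
  have hgb : ∀ T, g T ∈ Set.Icc 0 (a * (n * M) ^ 2) := by
    intro T
    refine ⟨by positivity, mul_le_mul_of_nonneg_left ?_ ha0.le⟩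
    exact pow_le_pow_left₀ (le_max_right _ _) (max_le (hΔb T).2 (by positivity)) 2
  have hDV := integral_le_toReal_klDiv_add_log Q P hQ
    hg hgb
  have hexpint : Integrable (fun T => Real.exp (g T)) P := by
    simpa using integrable_exp_mul_of_mem_Icc (t := 1)
      hg.aemeasurable
      (.of_forall hgb : ∀ᵐ T ∂P, g T ∈ Set.Icc 0 _)
  have hE : ∫ T, Real.exp (g T) ∂P ≤ n / δ := by
    rw [integral_eq_lintegral_of_nonneg_ae (.of_forall fun T => (Real.exp_pos _).le)
      hexpint.aestronglyMeasurable]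
    exact ENNReal.toReal_le_of_le_ofReal (by positivity) hlt.le
  have hE0 : 0 < ∫ T, Real.exp (g T) ∂P := integral_exp_pos hexpint
  have hlog := Real.log_le_log hE0 hE
  have hmax : Measurable fun T => max (Δ T) 0 := hΔ.max measurable_const
  have hmaxb : ∀ T, max (Δ T) 0 ∈ Set.Icc 0 (n * M) := fun T =>
    ⟨le_max_right _ _, max_le (hΔb T).2 (by positivity)⟩
  have hmaxint : Integrable (fun T => max (Δ T) 0) Q :=
    Integrable.of_mem_Icc _ _ hmax.aemeasurable (.of_forall hmaxb)
  have hmaxmem : MemLp (fun T => max (Δ T) 0) 2 Q :=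
    memLp_of_bounded (.of_forall hmaxb) hmax.aestronglyMeasurable 2
  have hmono : ∫ T, Δ T ∂Q ≤ ∫ T, max (Δ T) 0 ∂Q :=
    integral_mono (Integrable.of_mem_Icc _ _ hΔ.aemeasurable
      (.of_forall fun T => hΔb T)) hmaxint fun T => le_max_left _ _
  -- Jensen for the square, read off from nonnegativity of the variance.
  have hjensen : (∫ T, max (Δ T) 0 ∂Q) ^ 2 ≤
      ∫ T, (max (Δ T) 0) ^ 2 ∂Q := by
    have h1 := variance_eq_sub hmaxmem
    have h2 := variance_nonneg (fun T => max (Δ T) 0) Q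
    simp only [Pi.pow_apply] at h1
    linarith
  have hmul : ∫ T, g T ∂Q =
      a * ∫ T, (max (Δ T) 0) ^ 2 ∂Q := integral_const_mul _ _
  have hmain : a * (∫ T, max (Δ T) 0 ∂Q) ^ 2 ≤
      (klDiv Q P).toReal + Real.log (n / δ) := by
    have := mul_le_mul_of_nonneg_left hjensen ha0.le
    linarith
  rw [integral_div, div_le_iff₀ hn0]
  refine hmono.trans ?_
  set I := ∫ T, max (Δ T) 0 ∂Q
  have hI : I / (n * M) ≤
      √(((klDiv Q P).toReal + Real.log (n / δ)) / (2 * (n - 1))) := by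
    refine Real.le_sqrt_of_sq_le ?_
    rw [le_div_iff₀ (by positivity)]
    refine Eq.trans_le ?_ hmain
    rw [ha]; field_simp
  rw [div_le_iff₀ (by positivity)] at hI
  linarith

lemma measurable_lintegral_kernel_fst {A Y : Type*} [MeasurableSpace A] [MeasurableSpace Y]
    (κ : Kernel A H) [IsMarkovKernel κ] {f : H → Y → ℝ≥0∞}
    (hf : Measurable fun q : H × Y => f q.1 q.2) :
    Measurable fun S : A × Y => ∫⁻ T, f T S.2 ∂(κ S.1) := by
  have := Measurable.lintegral_kernel_prod_right (κ := κ.prodMkRight Y)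
    (f := fun S T => f T S.2)
    (hf.comp (measurable_snd.prodMk (measurable_snd.comp measurable_fst)))
  simpa [Kernel.prodMkRight_apply] using this

/-- Once the first coordinate is fixed, the kernel gives a fixed measure, so Tonelli brings the
`ν`-integral inside, where `hb` applies. This is how a prior learned from independent data behaves
like a deterministic one. -/
lemma lintegral_lintegral_kernel_le {A Y : Type*} [MeasurableSpace A] [MeasurableSpace Y]
    (μ : Measure A) [IsProbabilityMeasure μ] (κ : Kernel A H) [IsMarkovKernel κ] (ν : Measure Y)
    [IsProbabilityMeasure ν] {f : H → Y → ℝ≥0∞} (hf : Measurable fun q : H × Y => f q.1 q.2)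
    {b : ℝ≥0∞} (hb : ∀ T, ∫⁻ y, f T y ∂ν ≤ b) :
    ∫⁻ S, ∫⁻ T, f T S.2 ∂(κ S.1) ∂(μ.prod ν) ≤ b := by
  rw [lintegral_prod _ (measurable_lintegral_kernel_fst κ hf).aemeasurable]
  have : ∀ x, ∫⁻ y, ∫⁻ T, f T y ∂(κ x) ∂ν ≤ b := by
    intro x
    rw [lintegral_lintegral_swap (f := fun y T => f T y) (hf.comp measurable_swap).aemeasurable]
    refine (lintegral_mono hb).trans ?_
    simp
  refine (lintegral_mono this).trans ?_
  simp

/-- **PAC-Bayes bound** (McAllester) with a data-dependent prior that is independent of the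
sample. -/
theorem measure_not_pacBayes_le {A : Type*} [MeasurableSpace A] (μ : Measure A)
    [IsProbabilityMeasure μ] (prior : Kernel A H) [IsMarkovKernel prior] (D : Measure Z)
    [IsProbabilityMeasure D] {n : ℕ} (hn : 2 ≤ n) {M : ℝ} {ℓ : H → Z → ℝ}
    (hℓ : Measurable fun q : H × Z => ℓ q.1 q.2) (hℓM : ∀ T z, ℓ T z ∈ Set.Icc 0 M)
    {δ : ℝ} (hδ : 0 < δ) :
    (μ.prod (Measure.pi fun _ : Fin n => D)) {S | ¬ ∀ Q : ProbabilityMeasure H,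
      klDiv (Q : Measure H) (prior S.1) ≠ ∞ →
      ∫ T, ∫ z, ℓ T z ∂D ∂(Q : Measure H) - ∫ T, (1 / (n : ℝ)) * ∑ i, ℓ T (S.2 i) ∂(Q : Measure H)
        ≤ M * √(((klDiv (Q : Measure H) (prior S.1)).toReal + Real.log (n / δ)) / (2 * (n - 1)))}
      ≤ ENNReal.ofReal δ := by
  have hn1 : (0 : ℝ) < n - 1 := by
    have : (2 : ℝ) ≤ n := by exact_mod_cast hn
    linarith
  have hn0 : (0 : ℝ) < n := by linarith
  have hA : Nonempty A := nonempty_of_isProbabilityMeasure μ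
  obtain ⟨a₀⟩ := hA
  obtain ⟨T₀⟩ : Nonempty H := nonempty_of_isProbabilityMeasure (prior a₀)
  obtain ⟨z₀⟩ : Nonempty Z := nonempty_of_isProbabilityMeasure D
  have hM : 0 ≤ M := (hℓM T₀ z₀).1.trans (hℓM T₀ z₀).2
  have hℓT : ∀ T, Measurable (ℓ T) := fun T => hℓ.comp measurable_prodMk_left
  have hℓz : ∀ z, Measurable fun T => ℓ T z := fun z => hℓ.comp measurable_prodMk_right
  have hR : Measurable fun T => ∫ z, ℓ T z ∂D :=
    (StronglyMeasurable.integral_prod_right (f := ℓ) hℓ.stronglyMeasurable).measurable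
  let Δ : H → (Fin n → Z) → ℝ := fun T S => ∑ i, (∫ z, ℓ T z ∂D - ℓ T (S i))
  have hΔ : Measurable fun q : H × (Fin n → Z) => Δ q.1 q.2 :=
    Finset.measurable_fun_sum _ fun i _ => (hR.comp measurable_fst).sub
      (hℓ.comp (measurable_fst.prodMk ((measurable_pi_apply i).comp measurable_snd)))
  have hΔS : ∀ S, Measurable fun T => Δ T S := fun S => hΔ.comp measurable_prodMk_right
  have hΔb : ∀ T S, Δ T S ∈ Set.Icc (-(n * M)) (n * M) := fun T S =>
    sum_sub_mem_Icc (fun _ => integral_mem_Icc (hℓT T) (hℓM T)) fun i => hℓM T (S i)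
  have hgap : ∀ (S : Fin n → Z) (Q : ProbabilityMeasure H),
      ∫ T, ∫ z, ℓ T z ∂D ∂(Q : Measure H) - ∫ T, (1 / (n : ℝ)) * ∑ i, ℓ T (S i) ∂(Q : Measure H) =
        ∫ T, Δ T S / n ∂(Q : Measure H) := by
    intro S Q
    rw [← integral_sub]
    · refine integral_congr_ae (.of_forall fun T => ?_)
      simp only [Δ, Finset.sum_sub_distrib, Finset.sum_const, Finset.card_univ, Fintype.card_fin,
        nsmul_eq_mul]
      field_simp
    · exact Integrable.of_mem_Icc 0 M hR.aemeasurable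
        (.of_forall fun T => integral_mem_Icc (hℓT T) (hℓM T))
    · refine (integrable_finsetSum _ fun i _ => ?_).const_mul _
      exact Integrable.of_mem_Icc 0 M (hℓz _).aemeasurable (.of_forall fun T => hℓM T _)
  -- For `M = 0` the rate `a` below would divide by zero; all deviations vanish in that case.
  rcases hM.eq_or_lt with rfl | hM
  · refine (measure_mono_null ?_ (measure_empty)).le.trans zero_le
    intro S hS
    refine hS fun Q _ => ?_
    have h0 : ∀ T, Δ T S.2 = 0 := fun T => by simpa using hΔb T S.2
    rw [hgap]
    simp [h0]
  set a : ℝ := 2 * (n - 1) / (n ^ 2 * M ^ 2) with ha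
  have ha0 : 0 < a := by positivity
  let g : H → (Fin n → Z) → ℝ := fun T S => a * (max (Δ T S) 0) ^ 2
  have hg : Measurable fun q : H × (Fin n → Z) => g q.1 q.2 :=
    ((hΔ.max measurable_const).pow_const 2).const_mul a
  let Φ : A × (Fin n → Z) → ℝ≥0∞ := fun S => ∫⁻ T, ENNReal.ofReal (Real.exp (g T S.2)) ∂(prior S.1)
  have hgexp : Measurable fun q : H × (Fin n → Z) => ENNReal.ofReal (Real.exp (g q.1 q.2)) :=
    (Real.measurable_exp.comp hg).ennreal_ofReal
  have hΦ : Measurable Φ := measurable_lintegral_kernel_fst prior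
    (f := fun T S => ENNReal.ofReal (Real.exp (g T S))) hgexp
  have hΦint : ∫⁻ S, Φ S ∂(μ.prod (Measure.pi fun _ : Fin n => D)) ≤ n :=
    lintegral_lintegral_kernel_le μ prior (Measure.pi fun _ : Fin n => D)
      (f := fun T S => ENNReal.ofReal (Real.exp (g T S))) hgexp fun T =>
      lintegral_exp_sq_deviation_le D hn hM (hℓT T) (hℓM T)
  -- The covering event does not mention `Q`, which makes the bound uniform over posteriors; it is
  -- also measurable, as the original event need not be.
  have hbad : {S : A × (Fin n → Z) | ¬ ∀ Q : ProbabilityMeasure H,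
      klDiv (Q : Measure H) (prior S.1) ≠ ∞ →
      ∫ T, ∫ z, ℓ T z ∂D ∂(Q : Measure H) - ∫ T, (1 / (n : ℝ)) * ∑ i, ℓ T (S.2 i) ∂(Q : Measure H)
        ≤ M * √(((klDiv (Q : Measure H) (prior S.1)).toReal + Real.log (n / δ)) / (2 * (n - 1)))} ⊆
      {S | ENNReal.ofReal (n / δ) ≤ Φ S} := by
    intro S hS
    by_contra hlt
    replace hlt : Φ S < ENNReal.ofReal (n / δ) := not_le.1 hlt
    refine hS fun Q hQ => ?_
    rw [hgap]
    exact integral_le_of_lintegral_exp_sq_lt (Q : Measure H) (prior S.1) hQ (by linarith) hM hδ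
      (hΔS S.2) (fun T => hΔb T S.2) hlt
  refine (measure_mono hbad).trans ?_
  have hpos : ENNReal.ofReal (n / δ) ≠ 0 := by
    rw [ne_eq, ENNReal.ofReal_eq_zero, not_le]; positivity
  refine (meas_ge_le_lintegral_div hΦ.aemeasurable hpos ENNReal.ofReal_ne_top).trans ?_
  rw [ENNReal.div_le_iff hpos ENNReal.ofReal_ne_top, ← ENNReal.ofReal_mul hδ.le,
    mul_div_cancel₀ _ hδ.ne']
  simpa using hΦint

end PACBayes

/-! ### Rademacher averages of norm-bounded networks -/

section Peeling

open WithLp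

lemma frobNorm_nonneg {a b : Type*} [Fintype a] [Fintype b] (W : Matrix a b ℝ) :
    0 ≤ frobNorm W := by
  open scoped Matrix.Norms.Frobenius in exact norm_nonneg W

lemma frobNorm_sq {a b : Type*} [Fintype a] [Fintype b] (W : Matrix a b ℝ) :
    frobNorm W ^ 2 = ∑ j, ‖toLp 2 (W j)‖ ^ 2 := by
  unfold frobNorm
  rw [Matrix.frobenius_norm_def, ← Real.sqrt_eq_rpow, Real.sq_sqrt (by positivity)]
  refine Finset.sum_congr rfl fun j _ => ?_
  rw [EuclideanSpace.norm_sq_eq]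
  simp

lemma norm_row_le_frobNorm {a b : Type*} [Fintype a] [Fintype b] (W : Matrix a b ℝ) (j : a) :
    ‖toLp 2 (W j)‖ ≤ frobNorm W := by
  refine (sq_le_sq₀ (norm_nonneg _) (frobNorm_nonneg W)).1 ?_
  rw [frobNorm_sq]
  exact Finset.single_le_sum (f := fun j => ‖toLp 2 (W j)‖ ^ 2) (fun _ _ => sq_nonneg _)
    (Finset.mem_univ j)

lemma dotProduct_le_norm_mul_norm {b : Type*} [Fintype b] (u v : b → ℝ) :
    u ⬝ᵥ v ≤ ‖toLp 2 u‖ * ‖toLp 2 v‖ := by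
  have := real_inner_le_norm (toLp 2 v) (toLp 2 u)
  rw [EuclideanSpace.inner_toLp_toLp] at this
  simpa [mul_comm] using this

variable {ι : Type*} [Fintype ι] {a b : ℕ}

/-- For a positively homogeneous activation, the worst layer of given Frobenius norm is a single
neuron. -/
lemma exists_neuron {s : ℝ → ℝ} (hs0 : s 0 = 0) (hs : ∀ r : ℝ, 0 < r → ∀ u, s (r * u) = r * s u)
    {W : Matrix (Fin a) (Fin b) ℝ} {M : ℝ} (hW : frobNorm W ≤ M) (c : ι → ℝ)
    (h : ι → Fin b → ℝ) :
    ∃ u : Fin b → ℝ, ‖toLp 2 u‖ ≤ 1 ∧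
      ‖toLp 2 (fun j => ∑ i, c i * s ((W *ᵥ h i) j))‖ ≤ M * |∑ i, c i * s (u ⬝ᵥ h i)| := by
  have hM : 0 ≤ M := (frobNorm_nonneg W).trans hW
  cases isEmpty_or_nonempty (Fin a)
  · refine ⟨0, by simp, ?_⟩
    have : ‖toLp 2 (fun j => ∑ i, c i * s ((W *ᵥ h i) j))‖ = 0 := by
      rw [EuclideanSpace.norm_eq]; simp
    rw [this]
    positivity
  let r : Fin a → ℝ := fun j => ‖toLp 2 (W j)‖
  -- Homogeneity pulls the row norm out of `s`. A zero row gives `u j = 0` through `0⁻¹ = 0`, and `s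
  -- 0 = 0` keeps the identity true.
  let u : Fin a → Fin b → ℝ := fun j => (r j)⁻¹ • W j
  have hu : ∀ j, ‖toLp 2 (u j)‖ ≤ 1 := by
    intro j
    simp only [u, toLp_smul, norm_smul, norm_inv, r, norm_norm]
    exact inv_mul_le_one
  have hrow : ∀ j i, s ((W *ᵥ h i) j) = r j * s (u j ⬝ᵥ h i) := by
    intro j i
    rcases (norm_nonneg (toLp 2 (W j))).eq_or_lt with h0 | h0
    · have hr : r j = 0 := h0.symm
      have hWj : W j = 0 := by simpa using h0.symm
      rw [hr, zero_mul]
      simp [Matrix.mulVec, hWj, hs0]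
    · rw [← hs _ h0]
      simp only [u, smul_dotProduct, smul_eq_mul, r]
      rw [mul_inv_cancel_left₀ h0.ne']
      rfl
  -- The squared norm of the layer is a combination of squared neuron values with weights `r j ^ 2`
  -- of total `frobNorm W ^ 2`, so the best neuron dominates.
  obtain ⟨j₀, hj₀⟩ := Finite.exists_max fun j => |∑ i, c i * s (u j ⬝ᵥ h i)|
  refine ⟨u j₀, hu j₀, ?_⟩
  refine abs_le_of_sq_le_sq' ?_ (by positivity) |>.2
  rw [EuclideanSpace.norm_sq_eq]
  calc ∑ j, ‖∑ i, c i * s ((W *ᵥ h i) j)‖ ^ 2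
      = ∑ j, r j ^ 2 * |∑ i, c i * s (u j ⬝ᵥ h i)| ^ 2 := by
        refine Finset.sum_congr rfl fun j _ => ?_
        rw [← mul_pow, Real.norm_eq_abs, ← abs_of_nonneg (show 0 ≤ r j from norm_nonneg _), ← abs_mul,
          Finset.mul_sum]
        congr 2
        refine Finset.sum_congr rfl fun i _ => ?_
        rw [hrow]
        ring
    _ ≤ ∑ j, r j ^ 2 * |∑ i, c i * s (u j₀ ⬝ᵥ h i)| ^ 2 := by
        exact Finset.sum_le_sum fun j _ => mul_le_mul_of_nonneg_left
          (pow_le_pow_left₀ (abs_nonneg _) (hj₀ j) 2) (sq_nonneg _)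
    _ = frobNorm W ^ 2 * |∑ i, c i * s (u j₀ ⬝ᵥ h i)| ^ 2 := by
        rw [frobNorm_sq, Finset.sum_mul]
    _ ≤ (M * |∑ i, c i * s (u j₀ ⬝ᵥ h i)|) ^ 2 := by
        rw [mul_pow]
        have := frobNorm_nonneg W
        gcongr

variable [DecidableEq ι]

/-- Peeling off one layer of a network. -/
lemma sum_norm_layer_le {Θ : Type*} {s : ℝ → ℝ} (hLip : LipschitzWith 1 s) (hs0 : s 0 = 0)
    (hs : ∀ r : ℝ, 0 < r → ∀ u, s (r * u) = r * s u) (c : ι → ℝ) (h : Θ → ι → Fin b → ℝ) {A : ℝ}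
    (hA : ∀ θ : (ι → Bool) → Θ, ∑ ε, ‖toLp 2 (∑ i, (sgn (ε i) * c i) • h (θ ε) i)‖ ≤
      Fintype.card (ι → Bool) * A)
    {M : ℝ} (W : (ι → Bool) → Matrix (Fin a) (Fin b) ℝ) (hW : ∀ ε, frobNorm (W ε) ≤ M)
    (θ : (ι → Bool) → Θ) :
    ∑ ε, ‖toLp 2 (fun j => ∑ i, (sgn (ε i) * c i) * s ((W ε *ᵥ h (θ ε) i) j))‖ ≤
      Fintype.card (ι → Bool) * (2 * M * A) := by
  have hM : 0 ≤ M := (frobNorm_nonneg _).trans (hW fun _ => true)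
  -- Contraction strips the activation; the unit neuron is then removed by Cauchy–Schwarz. The
  -- neuron may depend on the signs.
  have hneuron : ∀ v : (ι → Bool) → {u : Fin b → ℝ // ‖toLp 2 u‖ ≤ 1} × Θ,
      ∑ ε, ∑ i, sgn (ε i) * (c i * s ((v ε).1.1 ⬝ᵥ h (v ε).2 i)) ≤
        Fintype.card (ι → Bool) * A := by
    intro v
    obtain ⟨v', hv'⟩ := exists_selection_le_scalar
      (fun i (q : {u : Fin b → ℝ // ‖toLp 2 u‖ ≤ 1} × Θ) => c i * s (q.1.1 ⬝ᵥ h q.2 i))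
      (fun i q => c i * (q.1.1 ⬝ᵥ h q.2 i)) (fun i p q => by
        rw [← mul_sub, ← mul_sub, abs_mul, abs_mul]
        have := hLip.dist_le_mul (p.1.1 ⬝ᵥ h p.2 i) (q.1.1 ⬝ᵥ h q.2 i)
        simp only [Real.dist_eq, NNReal.coe_one, one_mul] at this
        gcongr) v
    refine hv'.trans (le_trans (Finset.sum_le_sum fun ε _ => ?_) (hA fun ε => (v' ε).2))
    have : ∑ i, sgn (ε i) * (c i * ((v' ε).1.1 ⬝ᵥ h (v' ε).2 i)) =
        (v' ε).1.1 ⬝ᵥ ∑ i, (sgn (ε i) * c i) • h (v' ε).2 i := by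
      simp only [dotProduct_sum, dotProduct_smul, smul_eq_mul, mul_assoc]
    rw [this]
    exact (dotProduct_le_norm_mul_norm _ _).trans
      (mul_le_of_le_one_left (norm_nonneg _) (v' ε).1.2)
  have hex := fun ε => exists_neuron hs0 hs (hW ε) (fun i => sgn (ε i) * c i) (h (θ ε))
  choose u hu hbound using hex
  let X : (ι → Bool) → ℝ := fun ε => ∑ i, (sgn (ε i) * c i) * s (u ε ⬝ᵥ h (θ ε) i)
  -- The factor `2` pays for the absolute value, split into positive and negative parts. Where a
  -- part vanishes the zero neuron is selected; the negative part is made positive by reversing all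
  -- signs.
  have hX : ∑ ε, |X ε| ≤ 2 * (Fintype.card (ι → Bool) * A) := by
    have hpos : ∑ ε, max (X ε) 0 ≤ Fintype.card (ι → Bool) * A := by
      refine le_trans (le_of_eq (Finset.sum_congr rfl fun ε _ => ?_))
        (hneuron fun ε => (if 0 ≤ X ε then ⟨u ε, hu ε⟩ else ⟨0, by simp⟩, θ ε))
      split_ifs with h0
      · rw [max_eq_left h0]
        exact Finset.sum_congr rfl fun i _ => mul_assoc _ _ _
      · rw [max_eq_right (not_le.1 h0).le]
        simp [hs0]
    have hneg : ∑ ε, max (-X ε) 0 ≤ Fintype.card (ι → Bool) * A := by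
      rw [← sum_not]
      refine le_trans (le_of_eq (Finset.sum_congr rfl fun ε _ => ?_))
        (hneuron fun ε => (if X (fun i => !ε i) ≤ 0 then ⟨u fun i => !ε i, hu _⟩
          else ⟨0, by simp⟩, θ fun i => !ε i))
      split_ifs with h0
      · rw [max_eq_left (by linarith)]
        simp only [X, ← Finset.sum_neg_distrib, sgn_not]
        exact Finset.sum_congr rfl fun i _ => by ring
      · rw [max_eq_right (by linarith)]
        simp [hs0]
    have : ∀ ε, |X ε| = max (X ε) 0 + max (-X ε) 0 := by
      intro ε
      rcases le_total 0 (X ε) with h0 | h0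
      · rw [abs_of_nonneg h0, max_eq_left h0, max_eq_right (by linarith), add_zero]
      · rw [abs_of_nonpos h0, max_eq_right h0, max_eq_left (by linarith), zero_add]
    simp only [this, Finset.sum_add_distrib]
    linarith
  calc _ ≤ ∑ ε, M * |X ε| := Finset.sum_le_sum fun ε _ => hbound ε
    _ = M * ∑ ε, |X ε| := (Finset.mul_sum _ _ _).symm
    _ ≤ M * (2 * (Fintype.card (ι → Bool) * A)) := by gcongr
    _ = _ := by ring

lemma map_zero_of_homogeneous {s : ℝ → ℝ} (hs : ∀ r : ℝ, 0 < r → ∀ u, s (r * u) = r * s u) :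
    s 0 = 0 := by
  have := hs 2 two_pos 0
  rw [mul_zero] at this
  linarith

/-- The Rademacher average of the hidden layers of networks with bounded Frobenius norms. -/
lemma sum_norm_hidden_le {w : ℕ → ℕ} {σ : ℕ → ℝ → ℝ} {B : ℝ} (hB : 0 ≤ B) (m : ℕ → ℝ)
    (x : ι → EuclideanSpace ℝ (Fin (w 0))) (hx : ∀ i, ‖x i‖ ≤ B) (c : ι → ℝ)
    (hc : ∀ i, |c i| ≤ 1) (l : ℕ) (hLip : ∀ k < l, LipschitzWith 1 (σ k))
    (hHom : ∀ k < l, ∀ r : ℝ, 0 < r → ∀ u : ℝ, σ k (r * u) = r * σ k u)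
    (W : (ι → Bool) → ∀ k, Matrix (Fin (w (k + 1))) (Fin (w k)) ℝ)
    (hW : ∀ ε, ∀ k < l, frobNorm (W ε k) ≤ m k) :
    ∑ ε, ‖toLp 2 (∑ i, (sgn (ε i) * c i) • hidden w σ (W ε) (x i).ofLp l)‖ ≤
      Fintype.card (ι → Bool) * ((∏ k ∈ Finset.range l, 2 * m k) * (B * √(Fintype.card ι))) := by
  induction l generalizing W with
  | zero =>
    have := sum_norm_sum_sgn_smul_le (fun i => c i • x i) hB fun i => by
      rw [norm_smul, Real.norm_eq_abs]
      exact (mul_le_of_le_one_left (norm_nonneg _) (hc i)).trans (hx i)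
    simp only [Finset.range_zero, Finset.prod_empty, one_mul]
    refine le_trans (le_of_eq ?_) this
    refine Finset.sum_congr rfl fun ε _ => ?_
    congr 1
    simp [hidden, toLp_sum, mul_smul]
  | succ l ih =>
    -- The parameter class constrains only the layers below `l`, the only ones that `hidden` reads
    -- at depth `l`.
    have hstep := sum_norm_layer_le (Θ := {W : ∀ k, Matrix (Fin (w (k + 1))) (Fin (w k)) ℝ //
        ∀ k < l, frobNorm (W k) ≤ m k}) (hLip l (Nat.lt_succ_self l))
      (map_zero_of_homogeneous (hHom l (Nat.lt_succ_self l))) (hHom l (Nat.lt_succ_self l)) c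
      (fun W i => hidden w σ W.1 (x i).ofLp l)
      (fun θ => ih (fun k hk => hLip k (by omega)) (fun k hk => hHom k (by omega))
        (fun ε => (θ ε).1) fun ε => (θ ε).2)
      (fun ε => W ε l) (fun ε => hW ε l (Nat.lt_succ_self l))
      (fun ε => ⟨W ε, fun k hk => hW ε k (by omega)⟩)
    rw [Finset.prod_range_succ]
    refine le_trans (le_of_eq ?_) (hstep.trans_eq (by ring))
    refine Finset.sum_congr rfl fun ε _ => ?_
    congr 2
    funext j
    simp [hidden, Finset.sum_apply]

end Peeling

/-! ### The cross-entropy loss -/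

section Loss

lemma loss_eq {C p : ℕ} {X : Set (EuclideanSpace ℝ (Fin p))} (T : TransitionMap C X)
    (z : Example C X) : loss T z = -Real.log (T z.1 z.2.2 z.2.1) := by
  simp [loss, crossEntropy, Pi.single_apply]

lemma sum_exp_pos {C : ℕ} (u : Fin C → ℝ) (k : Fin C) : 0 < ∑ k, Real.exp (u k) :=
  Finset.sum_pos (fun _ _ => Real.exp_pos _) ⟨k, Finset.mem_univ k⟩

lemma neg_log_rowSoftmax {C : ℕ} (t : Matrix (Fin C) (Fin C) ℝ) (i j : Fin C) :
    -Real.log (rowSoftmax t i j) = Real.log (∑ k, Real.exp (t i k)) - t i j := by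
  rw [rowSoftmax, Matrix.of_apply, Real.log_div (Real.exp_pos _).ne' (sum_exp_pos _ j).ne',
    Real.log_exp]
  ring

/-- Every `exp (u k)` is at most `exp (v k)` times the exponential of the whole `ℓ¹` distance; sum
over `k` and take logarithms. -/
lemma log_sum_exp_sub_le {C : ℕ} (u v : Fin C → ℝ) :
    Real.log (∑ k, Real.exp (u k)) - Real.log (∑ k, Real.exp (v k)) ≤ ∑ k, |u k - v k| := by
  cases isEmpty_or_nonempty (Fin C)
  · simp
  obtain ⟨k₀⟩ := ‹Nonempty (Fin C)›
  rw [sub_le_iff_le_add, Real.log_le_iff_le_exp (sum_exp_pos u k₀), Real.exp_add,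
    Real.exp_log (sum_exp_pos v k₀), Finset.mul_sum]
  refine Finset.sum_le_sum fun k _ => ?_
  rw [← Real.exp_add, Real.exp_le_exp]
  have h1 := Finset.single_le_sum (f := fun k => |u k - v k|) (fun _ _ => abs_nonneg _)
    (Finset.mem_univ k)
  have h2 := le_abs_self (u k - v k)
  linarith

/-- The cross-entropy loss is Lipschitz in the logits. -/
lemma abs_neg_log_rowSoftmax_sub_le {C : ℕ} (s t : Matrix (Fin C) (Fin C) ℝ) (i j : Fin C) :
    |-Real.log (rowSoftmax s i j) - -Real.log (rowSoftmax t i j)| ≤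
      ∑ k, |2 * s i k - 2 * t i k| := by
  rw [neg_log_rowSoftmax, neg_log_rowSoftmax]
  -- One `ℓ¹` distance pays for the log-partition function and one for the selected logit, whence
  -- the factor `2`.
  have h1 := log_sum_exp_sub_le (s i) (t i)
  have h2 := log_sum_exp_sub_le (t i) (s i)
  simp only [fun k => abs_sub_comm (t i k) (s i k)] at h2
  have h3 := Finset.single_le_sum (f := fun k => |s i k - t i k|) (fun _ _ => abs_nonneg _)
    (Finset.mem_univ j)
  have h4 := abs_le.1 (le_refl |s i j - t i j|)
  simp only [← mul_sub, abs_mul, abs_two, ← Finset.mul_sum]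
  rw [abs_le]
  constructor <;> linarith [h4.1, h4.2]

/-- The Rademacher average of the cross-entropy loss of networks with bounded Frobenius norms. -/
theorem sum_sgn_loss_network_le {C L : ℕ} {w : ℕ → ℕ} {σ : ℕ → ℝ → ℝ} {B : ℝ}
    {Mw : Fin (L + 1) → ℝ} (hLip : ∀ k < L, LipschitzWith 1 (σ k))
    (hHom : ∀ k < L, ∀ a : ℝ, 0 < a → ∀ u : ℝ, σ k (a * u) = a * σ k u)
    {X : Set (EuclideanSpace ℝ (Fin (w 0)))} (hX : ∀ x ∈ X, ‖x‖ ≤ B) {n : ℕ} (hn : 0 < n)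
    (S : Fin n → Example C X)
    (W : (Fin n → Bool) → ∀ k, Matrix (Fin (w (k + 1))) (Fin (w k)) ℝ)
    (V : (Fin n → Bool) → Matrix (Fin C × Fin C) (Fin (w L)) ℝ)
    (hW : ∀ ε, ∀ k : Fin L, frobNorm (W ε k) ≤ Mw k.castSucc)
    (hV : ∀ ε, frobNorm (V ε) ≤ Mw (Fin.last L)) :
    ∑ ε, ∑ i, sgn (ε i) * loss (fun x : X => rowSoftmax (network C L w σ (W ε) (V ε)
        (x : EuclideanSpace ℝ (Fin (w 0))).ofLp)) (S i) ≤
      Fintype.card (Fin n → Bool) *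
        (2 * C ^ 3 * Mw (Fin.last L) * (∏ k : Fin L, 2 * Mw k.castSucc) * B * √n) := by
  have hB : 0 ≤ B := (norm_nonneg _).trans (hX _ (S ⟨0, hn⟩).1.2)
  have hC : Nonempty (Fin C) := ⟨(S ⟨0, hn⟩).2.1⟩
  have hlast : 0 ≤ Mw (Fin.last L) := (frobNorm_nonneg _).trans (hV fun _ => true)
  let Θ := {θ : (∀ k, Matrix (Fin (w (k + 1))) (Fin (w k)) ℝ) ×
    Matrix (Fin C × Fin C) (Fin (w L)) ℝ //
      (∀ k : Fin L, frobNorm (θ.1 k) ≤ Mw k.castSucc) ∧ frobNorm θ.2 ≤ Mw (Fin.last L)}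
  let h : Θ → Fin n → Fin (w L) → ℝ := fun θ i => hidden w σ θ.1.1 (S i).1.1.ofLp L
  let t : Θ → Fin n → Matrix (Fin C) (Fin C) ℝ := fun θ i =>
    network C L w σ θ.1.1 θ.1.2 (S i).1.1.ofLp
  -- The selected column `k i` does not depend on the signs, so each data point reads one fixed
  -- output entry `((S i).2.2, k i)`.
  obtain ⟨θ, k, hθ⟩ := exists_selection_le (ι := Fin n) (Θ := Θ) (κ := Fin C)
    (fun i θ => -Real.log (rowSoftmax (t θ i) (S i).2.2 (S i).2.1))
    (fun i k θ => 2 * t θ i (S i).2.2 k)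
    (fun i a b => abs_neg_log_rowSoftmax_sub_le _ _ _ _) (fun ε => ⟨(W ε, V ε), hW ε, hV ε⟩)
  let m : ℕ → ℝ := fun k => if hk : k < L then Mw (Fin.castSucc ⟨k, hk⟩) else 0
  have hprod : ∏ k ∈ Finset.range L, 2 * m k = ∏ k : Fin L, 2 * Mw k.castSucc := by
    rw [← Fin.prod_univ_eq_prod_range]
    refine Finset.prod_congr rfl fun k _ => ?_
    simp only [m, dif_pos k.2]
  -- The indicator weights sort the data points by the output entry they read. The linear top layer
  -- then costs only the norm of row `q`, and the `C ^ 2` cells combine with the factor `2 * C` into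
  -- `2 * C ^ 3`.
  have hcell : ∀ q : Fin C × Fin C, ∑ ε, ‖WithLp.toLp 2 (∑ i, (sgn (ε i) *
      (if ((S i).2.2, k i) = q then 1 else 0)) • h (θ ε) i)‖ ≤
      Fintype.card (Fin n → Bool) * ((∏ k : Fin L, 2 * Mw k.castSucc) * (B * √n)) := by
    intro q
    have := sum_norm_hidden_le (σ := σ) hB m (fun i => (S i).1.1) (fun i => hX _ (S i).1.2)
      (fun i => if ((S i).2.2, k i) = q then 1 else 0) (fun i => by split_ifs <;> simp) L hLip hHom
      (fun ε => (θ ε).1.1) (fun ε k hk => by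
        simpa [m, hk] using (θ ε).2.1 ⟨k, hk⟩)
    rw [hprod, Fintype.card_fin] at this
    exact this
  have hεsum : ∀ ε, ∑ i, sgn (ε i) * (Fintype.card (Fin C) * (2 * t (θ ε) i (S i).2.2 (k i))) ≤
      2 * C * Mw (Fin.last L) * ∑ q, ‖WithLp.toLp 2 (∑ i, (sgn (ε i) *
        (if ((S i).2.2, k i) = q then 1 else 0)) • h (θ ε) i)‖ := by
    intro ε
    have h1 : ∑ i, sgn (ε i) * (Fintype.card (Fin C) * (2 * t (θ ε) i (S i).2.2 (k i))) =
        2 * C * ∑ q, (θ ε).1.2 q ⬝ᵥ ∑ i, (sgn (ε i) *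
          (if ((S i).2.2, k i) = q then 1 else 0)) • h (θ ε) i := by
      simp only [dotProduct_sum, dotProduct_smul, smul_eq_mul]
      rw [Finset.sum_comm, Finset.mul_sum]
      refine Finset.sum_congr rfl fun i _ => ?_
      rw [Finset.sum_eq_single ((S i).2.2, k i)]
      · rw [if_pos rfl, Fintype.card_fin]
        change _ * (_ * (2 * ((θ ε).1.2 ((S i).2.2, k i) ⬝ᵥ h (θ ε) i))) = _
        ring
      · intro q _ hq
        rw [if_neg hq.symm]; ring
      · simp
    rw [h1, mul_assoc _ (Mw (Fin.last L)), Finset.mul_sum Finset.univ _ (Mw (Fin.last L))]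
    refine mul_le_mul_of_nonneg_left (Finset.sum_le_sum fun q _ => ?_) (by positivity)
    refine (dotProduct_le_norm_mul_norm _ _).trans ?_
    gcongr
    exact (norm_row_le_frobNorm _ q).trans (θ ε).2.2
  calc _ = ∑ ε, ∑ i, sgn (ε i) * -Real.log (rowSoftmax (network C L w σ (W ε) (V ε)
        (S i).1.1.ofLp) (S i).2.2 (S i).2.1) := by simp only [loss_eq]
    _ ≤ _ := hθ
    _ ≤ _ := Finset.sum_le_sum fun ε _ => hεsum ε
    _ = 2 * C * Mw (Fin.last L) * ∑ q, ∑ ε, ‖WithLp.toLp 2 (∑ i, (sgn (ε i) *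
        (if ((S i).2.2, k i) = q then 1 else 0)) • h (θ ε) i)‖ := by
        rw [← Finset.mul_sum, Finset.sum_comm]
    _ ≤ 2 * C * Mw (Fin.last L) * ∑ _q : Fin C × Fin C, (Fintype.card (Fin n → Bool) *
        ((∏ k : Fin L, 2 * Mw k.castSucc) * (B * √n))) := by
        gcongr with q; exact hcell q
    _ = _ := by
        rw [Finset.sum_const, Finset.card_univ, Fintype.card_prod, Fintype.card_fin, nsmul_eq_mul]
        push_cast; ring

end Loss

/-! ### Regularity of the hypothesis space -/

section Regularity

variable {C L : ℕ} {w : ℕ → ℕ} {σ : ℕ → ℝ → ℝ} {Mw : Fin (L + 1) → ℝ}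
  {X : Set (EuclideanSpace ℝ (Fin (w 0)))}

lemma continuous_hidden {l : ℕ} (hσ : ∀ k < l, Continuous (σ k)) :
    Continuous fun q : (∀ k, Matrix (Fin (w (k + 1))) (Fin (w k)) ℝ) × (Fin (w 0) → ℝ) =>
      hidden w σ q.1 q.2 l := by
  induction l with
  | zero => exact continuous_snd
  | succ l ih =>
    refine continuous_pi fun i => (hσ l (Nat.lt_succ_self l)).comp ?_
    exact (continuous_apply i).comp ((((continuous_apply l).comp continuous_fst)).matrix_mulVec
      (ih fun k hk => hσ k (by omega)))

lemma continuous_network (hσ : ∀ k < L, Continuous (σ k)) :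
    Continuous fun q : ((∀ k, Matrix (Fin (w (k + 1))) (Fin (w k)) ℝ) ×
      Matrix (Fin C × Fin C) (Fin (w L)) ℝ) × (Fin (w 0) → ℝ) =>
      network C L w σ q.1.1 q.1.2 q.2 := by
  refine continuous_matrix fun i j => ?_
  exact (continuous_apply (i, j)).comp ((continuous_snd.comp continuous_fst).matrix_mulVec
    ((continuous_hidden hσ).comp ((continuous_fst.comp continuous_fst).prodMk continuous_snd)))

lemma continuous_rowSoftmax : Continuous (rowSoftmax : Matrix (Fin C) (Fin C) ℝ → _) := by
  refine continuous_matrix fun i j => ?_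
  refine Continuous.div ?_ ?_ fun t => (sum_exp_pos (t i) j).ne'
  · exact Real.continuous_exp.comp (continuous_id.matrix_elem i j)
  · exact continuous_finsetSum _ fun k _ =>
      Real.continuous_exp.comp (continuous_id.matrix_elem i k)

lemma rowSoftmax_pos (t : Matrix (Fin C) (Fin C) ℝ) (i j : Fin C) : 0 < rowSoftmax t i j :=
  div_pos (Real.exp_pos _) (sum_exp_pos (t i) j)

lemma rowSoftmax_le_one (t : Matrix (Fin C) (Fin C) ℝ) (i j : Fin C) : rowSoftmax t i j ≤ 1 :=
  div_le_one_of_le₀ (Finset.single_le_sum (f := fun k => Real.exp (t i k))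
    (fun _ _ => (Real.exp_pos _).le) (Finset.mem_univ j)) (sum_exp_pos (t i) j).le

lemma continuous_of_mem_hypothesisSpace (hσ : ∀ k < L, Continuous (σ k)) {T : TransitionMap C X}
    (hT : T ∈ hypothesisSpace C L w σ Mw X) (i j : Fin C) : Continuous fun x => T x i j := by
  obtain ⟨W, V, -, -, hT⟩ := hT
  simp only [hT]
  refine Continuous.matrix_elem (continuous_rowSoftmax.comp ?_) i j
  exact (continuous_network hσ).comp ((continuous_const (y := (W, V))).prodMk
    ((PiLp.continuous_ofLp 2 _).comp continuous_subtype_val))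

lemma loss_nonneg_of_mem {T : TransitionMap C X} (hT : T ∈ hypothesisSpace C L w σ Mw X)
    (z : Example C X) : 0 ≤ loss T z := by
  obtain ⟨W, V, -, -, hT⟩ := hT
  rw [loss_eq, hT, neg_nonneg]
  exact Real.log_nonpos (rowSoftmax_pos _ _ _).le (rowSoftmax_le_one _ _ _)

/-- Entries of `T x` are continuous in `x` and, for the evaluation σ-algebra, measurable in `T`;
such Carathéodory functions are jointly measurable. The labels range over a finite set. -/
lemma measurable_loss (hσ : ∀ k < L, Continuous (σ k)) :
    Measurable fun q : hypothesisSpace C L w σ Mw X × Example C X =>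
      loss (q.1 : TransitionMap C X) q.2 := by
  have hentry : ∀ y : Fin C × Fin C, Measurable fun q : X × hypothesisSpace C L w σ Mw X =>
      (q.2 : TransitionMap C X) q.1 y.2 y.1 := fun y =>
    measurable_uncurry_of_continuous_of_measurable
      (u := fun x (T : hypothesisSpace C L w σ Mw X) => (T : TransitionMap C X) x y.2 y.1)
      (fun T => continuous_of_mem_hypothesisSpace hσ T.2 _ _)
      (fun x => (measurable_pi_apply y.1).comp ((measurable_pi_apply y.2).comp
        ((measurable_pi_apply x).comp measurable_subtype_coe)))
  have hall : Measurable fun q : (X × hypothesisSpace C L w σ Mw X) × (Fin C × Fin C) =>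
      (q.1.2 : TransitionMap C X) q.1.1 q.2.2 q.2.1 := measurable_from_prod_countable_left hentry
  simp only [loss_eq]
  exact (Real.measurable_log.comp (hall.comp (((measurable_fst.comp measurable_snd).prodMk
    measurable_fst).prodMk (measurable_snd.comp measurable_snd)))).neg

/-- Uniform convergence over the hypothesis space. -/
theorem measure_exists_risk_gt_le (hLip : ∀ k < L, LipschitzWith 1 (σ k))
    (hHom : ∀ k < L, ∀ a : ℝ, 0 < a → ∀ u : ℝ, σ k (a * u) = a * σ k u)
    {B : ℝ} (hX : ∀ x ∈ X, ‖x‖ ≤ B) {M : ℝ}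
    (hM : ∀ T ∈ hypothesisSpace C L w σ Mw X, ∀ z : Example C X, loss T z ≤ M)
    {n : ℕ} (hn : 0 < n) (D : Measure (Example C X)) [IsProbabilityMeasure D]
    {δ : ℝ} (hδ0 : 0 < δ) (hδ1 : δ < 1) :
    (Measure.pi fun _ : Fin n => D) {S | ∃ T ∈ hypothesisSpace C L w σ Mw X,
      (4 * C ^ 3 * Mw (Fin.last L) * (∏ k : Fin L, 2 * Mw k.castSucc) * B +
        M * √(Real.log (1 / δ) / 2)) / √n < risk D T - empRisk S T} ≤ ENNReal.ofReal δ := by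
  -- Uniform convergence needs a separable topology, which the space of weights supplies and the
  -- evaluation σ-algebra does not.
  let Θ := {θ : (∀ k, Matrix (Fin (w (k + 1))) (Fin (w k)) ℝ) ×
    Matrix (Fin C × Fin C) (Fin (w L)) ℝ //
      (∀ k : Fin L, frobNorm (θ.1 k) ≤ Mw k.castSucc) ∧ frobNorm θ.2 ≤ Mw (Fin.last L)}
  let τ : Θ → TransitionMap C X := fun θ x => rowSoftmax (network C L w σ θ.1.1 θ.1.2
    (x : EuclideanSpace ℝ (Fin (w 0))).ofLp)
  have hτ : ∀ θ, τ θ ∈ hypothesisSpace C L w σ Mw X := fun θ =>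
    ⟨θ.1.1, θ.1.2, θ.2.1, θ.2.2, fun x => rfl⟩
  have hτsurj : ∀ T ∈ hypothesisSpace C L w σ Mw X, ∃ θ, τ θ = T := by
    rintro T ⟨W, V, hW, hV, hT⟩
    exact ⟨⟨(W, V), hW, hV⟩, funext fun x => (hT x).symm⟩
  have hσ : ∀ k < L, Continuous (σ k) := fun k hk => (hLip k hk).continuous
  have hn0 : (0 : ℝ) < n := by exact_mod_cast hn
  have hIcc : ∀ θ z, loss (τ θ) z ∈ Set.Icc 0 M := fun θ z =>
    ⟨loss_nonneg_of_mem (hτ θ) z, hM _ (hτ θ) z⟩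
  have hmeas : ∀ θ, Measurable (loss (τ θ)) := fun θ =>
    (measurable_loss (Mw := Mw) hσ).comp
      (measurable_prodMk_left (x := (⟨τ θ, hτ θ⟩ : hypothesisSpace C L w σ Mw X)))
  have hcont : ∀ z, Continuous fun θ => loss (τ θ) z := by
    intro z
    simp only [loss_eq]
    refine (Continuous.log ?_ fun θ => (rowSoftmax_pos _ _ _).ne').neg
    exact (continuous_rowSoftmax.comp ((continuous_network hσ).comp
      (continuous_subtype_val.prodMk continuous_const))).matrix_elem _ _
  have hsc : ∀ a b : Type, ∀ [Countable a] [Countable b],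
      SecondCountableTopology (Matrix a b ℝ) := fun a b =>
    inferInstanceAs (SecondCountableTopology (a → b → ℝ))
  have hsecond : SecondCountableTopology Θ := by
    have h1 := fun k => hsc (Fin (w (k + 1))) (Fin (w k))
    have h2 := hsc (Fin C × Fin C) (Fin (w L))
    exact TopologicalSpace.Subtype.secondCountableTopology _
  set ρ : ℝ := 2 * C ^ 3 * Mw (Fin.last L) * (∏ k : Fin L, 2 * Mw k.castSucc) * B * √n with hρ
  have hlog : 0 ≤ Real.log (1 / δ) := Real.log_nonneg (by rw [le_div_iff₀ hδ0]; linarith)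
  -- Solves `exp (-(2 * t ^ 2 / (n * M ^ 2))) = δ` when `M` is positive.
  set t : ℝ := M * √(n * Real.log (1 / δ) / 2) with ht
  rcases isEmpty_or_nonempty Θ with hΘ | ⟨⟨θ₀⟩⟩
  · refine (measure_mono_null ?_ measure_empty).le.trans zero_le
    rintro S ⟨T, hT, -⟩
    exact (hτsurj T hT).elim fun θ _ => hΘ.elim θ
  obtain ⟨z₀⟩ : Nonempty (Example C X) := nonempty_of_isProbabilityMeasure D
  have hM0 : 0 ≤ M := (hIcc θ₀ z₀).1.trans (hIcc θ₀ z₀).2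
  have ht0 : 0 ≤ t := by positivity
  have hbad : {S : Fin n → Example C X | ∃ T ∈ hypothesisSpace C L w σ Mw X,
      (4 * C ^ 3 * Mw (Fin.last L) * (∏ k : Fin L, 2 * Mw k.castSucc) * B +
        M * √(Real.log (1 / δ) / 2)) / √n < risk D T - empRisk S T} ⊆
      {S | ∃ θ, 2 * ρ + t < ∑ i, (∫ z, loss (τ θ) z ∂D - loss (τ θ) (S i))} := by
    rintro S ⟨T, hT, hlt⟩
    obtain ⟨θ, rfl⟩ := hτsurj T hT
    refine ⟨θ, ?_⟩
    have hsqrt : t = √n * (M * √(Real.log (1 / δ) / 2)) := by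
      rw [ht, mul_div_assoc, Real.sqrt_mul hn0.le]; ring
    have hsum : ∑ i, (∫ z, loss (τ θ) z ∂D - loss (τ θ) (S i)) =
        n * (risk D (τ θ) - empRisk S (τ θ)) := by
      rw [risk, empRisk, Finset.sum_sub_distrib]
      simp only [Finset.sum_const, Finset.card_univ, Fintype.card_fin, nsmul_eq_mul]
      field_simp
    rw [hsum]
    have hmul := mul_lt_mul_of_pos_left hlt hn0
    refine Eq.trans_lt ?_ hmul
    have hs : (0 : ℝ) < √n := Real.sqrt_pos.2 hn0
    have hnn : (n : ℝ) = √n * √n := (Real.mul_self_sqrt hn0.le).symm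
    rw [hsqrt, hρ, mul_div_assoc', eq_div_iff hs.ne']
    nth_rewrite 4 [hnn]
    ring
  refine (measure_mono hbad).trans ?_
  have hrad : ∀ (S : Fin n → Example C X) (θ : (Fin n → Bool) → Θ),
      ∑ ε, ∑ i, sgn (ε i) * loss (τ (θ ε)) (S i) ≤ Fintype.card (Fin n → Bool) * ρ := fun S θ =>
    sum_sgn_loss_network_le hLip hHom hX hn S (fun ε => (θ ε).1.1) (fun ε => (θ ε).1.2)
      (fun ε => (θ ε).2.1) (fun ε => (θ ε).2.2)
  -- For `M = 0` the tail bound degenerates to `1`. All losses vanish then, and the Rademacher bound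
  -- at a constant choice forces `0 ≤ ρ`, so no violation is possible.
  rcases hM0.eq_or_lt with rfl | hM1
  · refine (measure_mono_null ?_ measure_empty).le.trans zero_le
    rintro S ⟨θ, hθ⟩
    have h0 : ∀ z, loss (τ θ) z = 0 := fun z => by simpa using hIcc θ z
    have h1 := hrad S fun _ => θ
    have hcard : (0 : ℝ) < Fintype.card (Fin n → Bool) := by exact_mod_cast Fintype.card_pos
    simp only [h0, mul_zero, Finset.sum_const_zero] at h1
    have h2 : 0 ≤ ρ := nonneg_of_mul_nonneg_right h1 hcard
    simp only [h0, integral_zero, sub_zero, Finset.sum_const_zero] at hθ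
    linarith
  · refine (measure_exists_deviation_gt_le D hmeas hcont hIcc hrad ht0).trans ?_
    refine ENNReal.ofReal_le_ofReal (le_of_eq ?_)
    rw [ht, mul_pow, Real.sq_sqrt (by positivity)]
    have : 2 * (M ^ 2 * (n * Real.log (1 / δ) / 2)) / (n * M ^ 2) = Real.log (1 / δ) := by
      field_simp
    rw [this, one_div, Real.log_inv, neg_neg, Real.exp_log hδ0]

/-- The PAC-Bayes bound for stochastic transition maps. -/
theorem measure_not_stochRisk_le (hσ : ∀ k < L, Continuous (σ k)) {M : ℝ}
    (hM : ∀ T ∈ hypothesisSpace C L w σ Mw X, ∀ z : Example C X, loss T z ≤ M)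
    {A : Type*} [MeasurableSpace A] (μ : Measure A) [IsProbabilityMeasure μ]
    (prior : Kernel A (hypothesisSpace C L w σ Mw X)) [IsMarkovKernel prior]
    (D : Measure (Example C X)) [IsProbabilityMeasure D] {n : ℕ} (hn : 2 ≤ n)
    {δ : ℝ} (hδ : 0 < δ) :
    (μ.prod (Measure.pi fun _ : Fin n => D))
      {S | ¬ ∀ Q : ProbabilityMeasure (hypothesisSpace C L w σ Mw X),
        klDiv (Q : Measure (hypothesisSpace C L w σ Mw X)) (prior S.1) ≠ ∞ →
        stochRisk D (Q : Measure (hypothesisSpace C L w σ Mw X)) -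
            stochEmpRisk S.2 (Q : Measure (hypothesisSpace C L w σ Mw X)) ≤
          M * √(((klDiv (Q : Measure (hypothesisSpace C L w σ Mw X)) (prior S.1)).toReal +
            Real.log (n / δ)) / (2 * (n - 1)))}
      ≤ ENNReal.ofReal δ := by
  have hIcc : ∀ (T : hypothesisSpace C L w σ Mw X) z,
      loss (T : TransitionMap C X) z ∈ Set.Icc 0 M := fun T z =>
    ⟨loss_nonneg_of_mem T.2 z, hM _ T.2 z⟩
  have hstoch : ∀ Q : ProbabilityMeasure (hypothesisSpace C L w σ Mw X),
      stochRisk D (Q : Measure (hypothesisSpace C L w σ Mw X)) =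
        ∫ T : hypothesisSpace C L w σ Mw X, ∫ z, loss (T : TransitionMap C X) z ∂D
          ∂(Q : Measure (hypothesisSpace C L w σ Mw X)) := by
    intro Q
    refine integral_prod_symm _ ?_
    exact Integrable.of_mem_Icc 0 M ((measurable_loss hσ).comp measurable_swap).aemeasurable
      (.of_forall fun q => hIcc q.2 q.1)
  have := measure_not_pacBayes_le μ prior D hn
    (ℓ := fun T z => loss (T : TransitionMap C X) z) (measurable_loss hσ) hIcc hδ
  simp only [hstoch]
  exact this

end Regularity

end Crowd

/-! ### Combining the two bounds -/

theorem theorem2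
    -- number of classes, number of hidden layers (depth is `L + 1`), bound on the instances,
    -- bounds on the Frobenius norms of the weight matrices
    (C L : ℕ) (B : ℝ) (Mw : Fin (L + 1) → ℝ) :
    -- the constant of the `O(1 / √(m r))` term, depending on nothing else
    ∃ K : ℝ,
      ∀ (w : ℕ → ℕ) (σ : ℕ → ℝ → ℝ)
        (_hLip : ∀ k < L, LipschitzWith 1 (σ k))
        (_hHom : ∀ k < L, ∀ a : ℝ, 0 < a → ∀ u : ℝ, σ k (a * u) = a * σ k u)
        (X : Set (EuclideanSpace ℝ (Fin (w 0)))) (_hX : ∀ x ∈ X, ‖x‖ ≤ B)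
        -- upper bound on the loss
        (M : ℝ)
        (_hM : ∀ T ∈ Crowd.hypothesisSpace C L w σ Mw X, ∀ z : Crowd.Example C X,
          Crowd.loss T z ≤ M)
        -- the global and the individual distributions and the sample sizes
        (m r : ℕ) (_hm : 0 < m) (_hr : 0 < r)
        (DG : Measure (Crowd.Example C X)) (_hDG : IsProbabilityMeasure DG)
        (R : ℕ) (DI : Fin R → Measure (Crowd.Example C X))
        (_hDI : ∀ j, IsProbabilityMeasure (DI j))
        (mI : Fin R → ℕ) (_hmI : ∀ j, 2 ≤ mI j)
        -- the global transition matrix learned from the global sample, and the prior over the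
        -- hypothesis space that is associated with it
        (That : (Fin (m * r) → Crowd.Example C X) → Crowd.hypothesisSpace C L w σ Mw X)
        (prior : Kernel (Fin (m * r) → Crowd.Example C X) (Crowd.hypothesisSpace C L w σ Mw X))
        (_hprior : IsMarkovKernel prior)
        -- the transferability function and the stochastic hypotheses available to fine-tuning
        (ω : ℝ → ℝ) (_hω : Monotone ω)
        (Ttilde : (Fin (m * r) → Crowd.Example C X) →
          Set (ProbabilityMeasure (Crowd.hypothesisSpace C L w σ Mw X)))
        (_hKL : ∀ SG, ∀ Q ∈ Ttilde SG,
          ((klDiv (Q : Measure (Crowd.hypothesisSpace C L w σ Mw X)) (prior SG) : ℝ≥0∞) : EReal) ≤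
            ((ω (Crowd.risk DG (That SG : Crowd.TransitionMap C X)) : ℝ) : EReal))
        (j : Fin R) (δ : ℝ) (_hδ0 : 0 < δ) (_hδ1 : δ < 1),
        -- the event that one of the two bounds fails has (outer) probability at most `δ`
        ((Measure.pi fun _ : Fin (m * r) => DG).prod (Measure.pi fun _ : Fin (mI j) => DI j))
          {S | ¬ ((∀ Q ∈ Ttilde S.1,
                Crowd.stochRisk (DI j) (Q : Measure (Crowd.hypothesisSpace C L w σ Mw X))
                  - Crowd.stochEmpRisk S.2 (Q : Measure (Crowd.hypothesisSpace C L w σ Mw X)) ≤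
                M * √((ω (Crowd.risk DG (That S.1 : Crowd.TransitionMap C X))
                    + Real.log (2 * (mI j : ℝ) / δ)) / (2 * ((mI j : ℝ) - 1)))) ∧
              (∀ c : ℝ,
                Crowd.empRisk S.1 (That S.1 : Crowd.TransitionMap C X) ≤ c / √((m : ℝ) * r) →
                M * √((ω (Crowd.risk DG (That S.1 : Crowd.TransitionMap C X))
                    + Real.log (2 * (mI j : ℝ) / δ)) / (2 * ((mI j : ℝ) - 1))) ≤
                M * √((ω ((c + K + M * √(Real.log (2 / δ) / 2)) / √((m : ℝ) * r))
                    + Real.log (2 * (mI j : ℝ) / δ)) / (2 * ((mI j : ℝ) - 1)))))}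
          ≤ ENNReal.ofReal δ := by
  -- Twice the Rademacher bound of `sum_sgn_loss_network_le`, with its `√n` removed; no width
  -- enters.
  refine ⟨4 * C ^ 3 * Mw (Fin.last L) * (∏ k : Fin L, 2 * Mw k.castSucc) * B, ?_⟩
  intro w σ hLip hHom X hX M hM m r hm hr DG hDG R DI hDI mI hmI That prior hprior ω hω Ttilde hKL
    j δ hδ0 hδ1
  have hDIj := hDI j
  have hσ : ∀ k < L, Continuous (σ k) := fun k hk => (hLip k hk).continuous
  have hδ2 : 0 < δ / 2 := by linarith
  have hn : 0 < m * r := Nat.mul_pos hm hr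
  have hn1 : (0 : ℝ) < (mI j : ℝ) - 1 := by
    have : (2 : ℝ) ≤ mI j := by exact_mod_cast hmI j
    linarith
  obtain ⟨z₀⟩ : Nonempty (Crowd.Example C X) := nonempty_of_isProbabilityMeasure DG
  have hM0 : 0 ≤ M := (Crowd.loss_nonneg_of_mem (That fun _ => z₀).2 z₀).trans
    (hM _ (That fun _ => z₀).2 z₀)
  have hlogδ : (1 : ℝ) / (δ / 2) = 2 / δ := by field_simp
  have hlogn : (mI j : ℝ) / (δ / 2) = 2 * (mI j : ℝ) / δ := by field_simp
  have hind := Crowd.measure_not_stochRisk_le (σ := σ) (Mw := Mw) hσ hM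
    (Measure.pi fun _ : Fin (m * r) => DG) prior (DI j) (hmI j) hδ2
  have hglob := Crowd.measure_exists_risk_gt_le (σ := σ) (Mw := Mw) hLip hHom hX hM hn DG hδ2
    (by linarith)
  rw [hlogn] at hind
  rw [hlogδ, Nat.cast_mul] at hglob
  set ν := (Measure.pi fun _ : Fin (m * r) => DG).prod (Measure.pi fun _ : Fin (mI j) => DI j)
  set E₁ := {S : (Fin (m * r) → Crowd.Example C X) × (Fin (mI j) → Crowd.Example C X) |
    ¬ ∀ Q : ProbabilityMeasure (Crowd.hypothesisSpace C L w σ Mw X),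
      klDiv (Q : Measure (Crowd.hypothesisSpace C L w σ Mw X)) (prior S.1) ≠ ∞ →
      Crowd.stochRisk (DI j) (Q : Measure (Crowd.hypothesisSpace C L w σ Mw X)) -
        Crowd.stochEmpRisk S.2 (Q : Measure (Crowd.hypothesisSpace C L w σ Mw X)) ≤
      M * √(((klDiv (Q : Measure (Crowd.hypothesisSpace C L w σ Mw X)) (prior S.1)).toReal +
        Real.log (2 * (mI j : ℝ) / δ)) / (2 * ((mI j : ℝ) - 1)))}
  set E₂ := {S : Fin (m * r) → Crowd.Example C X | ∃ T ∈ Crowd.hypothesisSpace C L w σ Mw X,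
    (4 * C ^ 3 * Mw (Fin.last L) * (∏ k : Fin L, 2 * Mw k.castSucc) * B +
      M * √(Real.log (2 / δ) / 2)) / √((m : ℝ) * r) < Crowd.risk DG T - Crowd.empRisk S T}
  -- Only an inequality is available for the preimage, since `E₂` is not known to be measurable; it
  -- suffices.
  have hE₂ : ν (Prod.fst ⁻¹' E₂) ≤ ENNReal.ofReal (δ / 2) :=
    (measurePreserving_fst.measure_preimage_le E₂).trans hglob
  refine (measure_mono (t := E₁ ∪ Prod.fst ⁻¹' E₂) ?_).trans ((measure_union_le _ _).trans
    ((add_le_add hind hE₂).trans_eq ?_))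
  · intro S hS
    by_contra hnot
    rw [Set.mem_union, not_or] at hnot
    have h₁ := not_not.1 hnot.1
    refine hS ⟨fun Q hQ => ?_, fun c hc => ?_⟩
    · have hkl := hKL S.1 Q hQ
      -- `toReal` would turn an infinite divergence into `0`; the real upper bound from `ω` excludes
      -- this.
      have htop : klDiv (Q : Measure (Crowd.hypothesisSpace C L w σ Mw X)) (prior S.1) ≠ ∞ := by
        intro htop
        rw [htop] at hkl
        simp at hkl
      have hreal : (klDiv (Q : Measure (Crowd.hypothesisSpace C L w σ Mw X)) (prior S.1)).toReal ≤
          ω (Crowd.risk DG (That S.1 : Crowd.TransitionMap C X)) := by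
        rw [← EReal.coe_le_coe_iff, EReal.coe_ennreal_toReal htop]
        exact hkl
      refine (h₁ Q htop).trans ?_
      gcongr
    -- `E₂` covers every hypothesis, hence the data-dependent `That S.1`, and does not involve `c`,
    -- so all `c` are treated on the same event.
    · have h₂ : ¬ _ < _ := fun h => hnot.2 ⟨_, (That S.1).2, h⟩
      have hrisk : Crowd.risk DG (That S.1 : Crowd.TransitionMap C X) ≤
          (c + 4 * C ^ 3 * Mw (Fin.last L) * (∏ k : Fin L, 2 * Mw k.castSucc) * B +
            M * √(Real.log (2 / δ) / 2)) / √((m : ℝ) * r) := by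
        rw [add_assoc, add_div]
        linarith [not_lt.1 h₂]
      have hmono := hω hrisk
      gcongr
  · rw [← ENNReal.ofReal_add hδ2.le hδ2.le, add_halves]
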